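/- Throughout, $\mathbb R^{2n}$ ($n\ge 1$) carries the coordinates $(x_1,y_1,\dots,x_n,y_n)$, the standard inner product and the standard symplectic form $\sum_j dx_j\wedge dy_j$, and $B^{2n}$ is the open Euclidean unit ball. A symmetric convex body is a bounded convex set $K\subset\mathbb R^{2n}$ with non-empty interior and $K=-K$; $\|x\|_K=\inf\{r>0 : x\in rK\}$, $X_K$ is the normed space $(\mathbb R^{2n},\|\cdot\|_K)$, and $K^\circ=\{x : \langle x,y\rangle\le 1 \text{ for all } y\in K\}$. Put $$M^*(K)=\int_{S^{2n-1}}\|x\|_{K^\circ}\,\sigma(dx),\qquad s^*(K)=2^{-2n}\sum_{\varepsilon\in\{-1/\sqrt{2n},\,1/\sqrt{2n}\}^{2n}}\ \sup\Bigl\{\sum_i\varepsilon_i x_i : x\in K\Bigr\},$$ where $\sigma$ is the rotation-invariant probability measure on the sphere. For a normed space $X$ let $\|\mathrm{Rad}\|_X=\sup_m\|\mathcal R_m\|$, where $\mathcal R_m$ is the operator on $L^2(\{-1,1\}^m,X)$ (uniform probability measure) given by $\mathcal R_m f=\sum_{i=1}^m\hat f(\{i\})\,r_i$, with $r_i(t)=t_i$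 and $\hat f(\{i\})=2^{-m}\sum_t t_i f(t)$. **Theorem.** There exist universal constants $A_3,A_6>0$ such that for every $n\ge 1$ and every symmetric convex body $K\subset\mathbb R^{2n}$ there exist a diagonal transformation $D=\mathrm{diag}(r_1,r_1,r_2,r_2,\dots,r_n,r_n)$ with all $r_i>0$ and $\prod_{i=1}^n r_i=1$, and a linear symplectic transformation $S$ of $\mathbb R^{2n}$, such that, with $K'=SK$, $$s^*(DK')\ \le\ A_3\,M^*(DK')\ \le\ A_3A_6\,\|\mathrm{Rad}\|_{X_K}\left(\frac{\mathrm{Vol}(K)}{\mathrm{Vol}(B^{2n})}\right)^{1/(2n)}.$$ -/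

import Mathlib

open MeasureTheory
open scoped ENNReal

noncomputable section

namespace SymplecticMeanWidth

/-! ### The Rademacher projection constant of a normed space -/

section Rademacher

variable {X : Type*} [NormedAddCommGroup X] [NormedSpace ℝ X]

/-- The Walsh function `W_A(t) = ∏_{i ∈ A} t_i` on the group `Ω^m = {-1,1}^m`. -/
def walsh {m : ℕ} (A : Finset (Fin m)) (t : Fin m → ℤˣ) : ℝ :=
  ∏ i ∈ A, ((t i : ℤ) : ℝ)

/-- The Walsh coefficient `f̂(A) = 2^{-m} ∑_t f(t) W_A(t)` of `f : Ω^m → X`. -/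
def walshCoeff {m : ℕ} (f : (Fin m → ℤˣ) → X) (A : Finset (Fin m)) : X :=
  (1 / 2 ^ m : ℝ) • ∑ t, walsh A t • f t

/-- The norm of `L²(Ω^m, X)`, for the uniform probability measure on `Ω^m`. -/
def cubeL2Norm {m : ℕ} (f : (Fin m → ℤˣ) → X) : ℝ :=
  Real.sqrt ((1 / 2 ^ m : ℝ) * ∑ t, ‖f t‖ ^ 2)

/-- The Rademacher projection `R_m f = ∑_i f̂({i}) r_i`, where `r_i = W_{\{i\}}`. -/
def rademacherProj (m : ℕ) (f : (Fin m → ℤˣ) → X) : (Fin m → ℤˣ) → X :=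
  fun t => ∑ i, walsh {i} t • walshCoeff f {i}

variable (X) in
/-- The Rademacher projection constant `‖Rad‖_X`: the supremum over `m` of the operator norm
of the `m`-th Rademacher projection on `L²(Ω^m, X)`; it may be infinite. -/
def rademacherConst : ℝ≥0∞ :=
  ⨆ (m : ℕ) (f : (Fin m → ℤˣ) → X) (_ : cubeL2Norm f ≤ 1),
    ENNReal.ofReal (cubeL2Norm (rademacherProj m f))

end Rademacher

/-! ### Symmetric convex bodies and the normed spaces that they induce -/

/-- A (centrally) symmetric convex body: a bounded convex set with non-empty interior that is
symmetric about the origin. It need not be closed. -/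
structure SymmetricConvexBody (E : Type*) [NormedAddCommGroup E] [NormedSpace ℝ E] where
  carrier : Set E
  convex' : Convex ℝ carrier
  bounded' : Bornology.IsBounded carrier
  interior_nonempty' : (interior carrier).Nonempty
  neg_mem' : ∀ x ∈ carrier, -x ∈ carrier

namespace SymmetricConvexBody

variable {E : Type*} [NormedAddCommGroup E] [NormedSpace ℝ E] (K : SymmetricConvexBody E)

theorem mem_nhds_zero : K.carrier ∈ nhds (0 : E) := by
  obtain ⟨x, hx⟩ := K.interior_nonempty'
  have hx' : -x ∈ K.carrier := K.neg_mem' x (interior_subset hx)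
  have h := K.convex'.combo_interior_self_mem_interior hx hx' (a := 1 / 2) (b := 1 / 2)
    (by norm_num) (by norm_num) (by norm_num)
  have h0 : (1 / 2 : ℝ) • x + (1 / 2 : ℝ) • -x = 0 := by simp
  rw [h0] at h
  exact mem_interior_iff_mem_nhds.1 h

/-- The space `X_K`: the vector space `E` normed by the gauge `‖x‖_K = inf {r > 0 : x ∈ rK}`,
so that its unit ball is `K`. -/
def Space (_K : SymmetricConvexBody E) : Type _ := E

instance : AddCommGroup K.Space := inferInstanceAs (AddCommGroup E)

instance : Module ℝ K.Space := inferInstanceAs (Module ℝ E)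

instance : Norm K.Space := ⟨fun x => gauge K.carrier (show E from x)⟩

theorem normCore : NormedSpace.Core ℝ K.Space where
  norm_nonneg x := gauge_nonneg (E := E) x
  norm_smul c x := by
    change gauge K.carrier (c • (show E from x)) = ‖c‖ * gauge K.carrier (show E from x)
    rcases abs_choice c with h | h
    · have hc : 0 ≤ c := h ▸ abs_nonneg c
      rw [gauge_smul_of_nonneg hc, Real.norm_of_nonneg hc, smul_eq_mul]
    · have hc : 0 ≤ -c := h ▸ abs_nonneg c
      rw [← gauge_neg K.neg_mem', ← neg_smul, gauge_smul_of_nonneg hc, Real.norm_eq_abs, h,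
        smul_eq_mul]
  norm_triangle x y :=
    gauge_add_le (E := E) K.convex' (absorbent_nhds_zero K.mem_nhds_zero) x y
  norm_eq_zero_iff x :=
    gauge_eq_zero (E := E) (absorbent_nhds_zero K.mem_nhds_zero)
      (NormedSpace.isVonNBounded_of_isBounded ℝ K.bounded')

instance : NormedAddCommGroup K.Space := NormedAddCommGroup.ofCore K.normCore

instance : NormedSpace ℝ K.Space := NormedSpace.ofCore K.normCore

theorem norm_def (x : E) : ‖(show K.Space from x)‖ = gauge K.carrier x := rfl

end SymmetricConvexBody

/-! ### Mean width and Rademacher average -/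

section Width

variable {ι : Type*} [Fintype ι]

/-- The polar body `K° = {x : ⟨x, y⟩ ≤ 1 for all y ∈ K}`. -/
def polarBody (K : Set (EuclideanSpace ℝ ι)) : Set (EuclideanSpace ℝ ι) :=
  {x | ∀ y ∈ K, inner ℝ x y ≤ 1}

/-- `M(K)`: the average of `‖·‖_K` over the unit sphere, with respect to the normalized
rotation-invariant measure. -/
def meanNorm (K : Set (EuclideanSpace ℝ ι)) : ℝ :=
  ⨍ x : Metric.sphere (0 : EuclideanSpace ℝ ι) 1, gauge K (x : EuclideanSpace ℝ ι)
    ∂((volume : Measure (EuclideanSpace ℝ ι)).toSphere)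

/-- `M*(K) = M(K°)`, half the mean width of `K`. -/
def meanWidth (K : Set (EuclideanSpace ℝ ι)) : ℝ :=
  meanNorm (polarBody K)

/-- `s*(K)`: the average of `sup {∑ ε_i x_i : x ∈ K}` over all sign vectors
`ε ∈ {-1/√d, 1/√d}^d`, where `d` is the dimension. -/
def signWidth [DecidableEq ι] (K : Set (EuclideanSpace ℝ ι)) : ℝ :=
  (1 / 2 ^ Fintype.card ι : ℝ) * ∑ t : ι → ℤˣ,
    sSup ((fun x : EuclideanSpace ℝ ι =>
      ∑ i, (((t i : ℤ) : ℝ) / Real.sqrt (Fintype.card ι)) * x i) '' K)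

end Width

/-- `ℝ^{2n}`. The coordinate `x_i` has index `Sum.inl i` and `y_i` has index `Sum.inr i`; the
standard symplectic form is `∑ dx_i ∧ dy_i`, and the group of matrices that preserve it is
`Matrix.symplecticGroup (Fin n) ℝ`. -/
abbrev PhaseSpace (n : ℕ) : Type := EuclideanSpace ℝ (Fin n ⊕ Fin n)

/-- The linear map `diag(r_1, r_1, …, r_n, r_n)` of `ℝ^{2n}`: both `x_i` and `y_i` are
multiplied by `r_i`. -/
def pairDiagonal {n : ℕ} (r : Fin n → ℝ) : PhaseSpace n →ₗ[ℝ] PhaseSpace n :=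
  Matrix.toEuclideanLin (Matrix.diagonal (Sum.elim r r))

end SymplecticMeanWidth

end

open SymplecticMeanWidth

noncomputable section

namespace SymplecticMeanWidth

/-! ### Signs and the Rademacher projection -/

section Signs

variable {κ : Type*} [Fintype κ] [DecidableEq κ]

/-! The proof combines a Gaussian MM*-estimate with Williamson's normal form. Put d = 2n, let G be a
standard Gaussian vector, and write ℓ(u) for the quadratic mean of ‖uG‖_K.

Lewis position: a minimizer u of ℓ on {det = 1} exists, and the first-order condition reads ℓ(u)
tr(w v) ≤ d ℓ(v) for every operator v, where w = u⁻¹ (`exists_lewis_position`).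

Duality: let h be the support function of wK, let y(x) norm it, and test with v = E h(G) y(G) ⊗ G.
Then tr(w v) = E h(G)², while vG is the linear part of h(G) y(G), so ℓ(v) ≤ ‖Rad‖ (E h(G)²)^{1/2}.
Hence ℓ(u) (E h(G)²)^{1/2} ≤ d ‖Rad‖ (`gaussRMS_mul_gaussRMS_dual_le`). The bound on the linear part
is proved for normalized sums of signs, where it is the Rademacher projection, and passes to G by
the central limit theorem (`signCov_signSum`, `exists_gaussian_dual`).

Volume: Markov's inequality and the maximum of the Gaussian density give √d ≤ 5 ℓ(u) (Vol K / Vol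
B)^{1/d}. Eliminating ℓ(u) bounds M*(wK), because Gaussian and spherical averages of h differ by the
factor E‖G‖, which is comparable to √d.

Symplectic step: any T with det T = 1 equals O⁻¹DS with O orthogonal, D pair-diagonal of the
required kind and S symplectic (`exists_williamson`). As M* is rotation invariant, M*(DSK) = M*(TK);
take T = w. The comparison s* ≤ √(π/2) M* holds for every bounded symmetric set, by Jensen's
inequality (`IsSymmBounded.signWidth_le`). -/

theorem sign_mul_self (u : ℤˣ) : ((u : ℤ) : ℝ) * ((u : ℤ) : ℝ) = 1 := by
  rcases Int.units_eq_one_or u with h | h <;> simp [h]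

/-- Distinct signs are uncorrelated. -/
theorem sum_sign_mul_sign (k l : κ) :
    ∑ t : κ → ℤˣ, ((t k : ℤ) : ℝ) * ((t l : ℤ) : ℝ) =
      if k = l then 2 ^ Fintype.card κ else 0 := by
  split_ifs with h
  · subst h
    simp [sign_mul_self]
  -- Flipping the single sign t k permutes the cube and negates the summand.
  · have key : ∑ t : κ → ℤˣ, ((t k : ℤ) : ℝ) * ((t l : ℤ) : ℝ) =
        ∑ t : κ → ℤˣ, -(((t k : ℤ) : ℝ) * ((t l : ℤ) : ℝ)) := by
      have hinv : Function.Involutive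
          (fun t : κ → ℤˣ => Function.update t k (-t k)) := by
        intro t
        ext i
        by_cases hi : i = k
        · subst hi; simp
        · simp [hi]
      refine Fintype.sum_equiv hinv.toPerm _ _ fun t => ?_
      simp [Function.Involutive.toPerm, Function.update_of_ne (Ne.symm h)]
    rw [Finset.sum_neg_distrib] at key
    linarith

/-- The first Walsh coefficients of a vector valued function of the signs `t k`. -/
def signCoeff {X : Type*} [AddCommGroup X] [Module ℝ X] (f : (κ → ℤˣ) → X) (k : κ) : X :=
  (1 / 2 ^ Fintype.card κ : ℝ) • ∑ t, ((t k : ℤ) : ℝ) • f t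

/-- **Bessel's inequality** for the Rademacher functions. -/
theorem sum_norm_sq_signProj_le {H : Type*} [NormedAddCommGroup H] [InnerProductSpace ℝ H]
    (f : (κ → ℤˣ) → H) :
    ∑ t : κ → ℤˣ, ‖∑ k, ((t k : ℤ) : ℝ) • signCoeff f k‖ ^ 2 ≤ ∑ t, ‖f t‖ ^ 2 := by
  have hcoeff : ∀ k, ∑ t, ((t k : ℤ) : ℝ) • f t =
      (2 ^ Fintype.card κ : ℝ) • signCoeff f k := by
    intro k
    rw [signCoeff, smul_smul, mul_one_div_cancel (by positivity), one_smul]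
  have h1 : ∑ t, inner ℝ (f t) (∑ k, ((t k : ℤ) : ℝ) • signCoeff f k) =
      2 ^ Fintype.card κ * ∑ k, ‖signCoeff f k‖ ^ 2 := by
    simp_rw [inner_sum, inner_smul_right]
    rw [Finset.sum_comm, Finset.mul_sum]
    refine Finset.sum_congr rfl fun k _ => ?_
    simp_rw [← real_inner_smul_left]
    rw [← sum_inner, hcoeff, real_inner_smul_left, real_inner_self_eq_norm_sq]
  have h2 : ∑ t : κ → ℤˣ, ‖∑ k, ((t k : ℤ) : ℝ) • signCoeff f k‖ ^ 2 =
      2 ^ Fintype.card κ * ∑ k, ‖signCoeff f k‖ ^ 2 := by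
    simp_rw [← real_inner_self_eq_norm_sq, inner_sum, sum_inner, real_inner_smul_left,
      inner_smul_right]
    rw [Finset.sum_comm, Finset.mul_sum]
    refine Finset.sum_congr rfl fun k _ => ?_
    rw [Finset.sum_comm]
    simp_rw [← mul_assoc, ← Finset.sum_mul, sum_sign_mul_sign]
    simp
  -- The cross term and the square of the projection are the same number, so expanding this square
  -- leaves exactly the claim.
  have h3 : 0 ≤ ∑ t, ‖f t - ∑ k, ((t k : ℤ) : ℝ) • signCoeff f k‖ ^ 2 := by positivity
  simp_rw [norm_sub_sq_real] at h3
  rw [Finset.sum_add_distrib, Finset.sum_sub_distrib, ← Finset.mul_sum, h1] at h3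
  linarith [h2]

end Signs

section RademacherConst

variable {X : Type*} [NormedAddCommGroup X] [NormedSpace ℝ X]

theorem rademacherProj_apply {m : ℕ} (f : (Fin m → ℤˣ) → X) (t : Fin m → ℤˣ) :
    rademacherProj m f t = ∑ k, ((t k : ℤ) : ℝ) • signCoeff f k := by
  simp [rademacherProj, walshCoeff, walsh, signCoeff]

theorem cubeL2Norm_nonneg {Y : Type*} [NormedAddCommGroup Y] {m : ℕ} (f : (Fin m → ℤˣ) → Y) : 0 ≤ cubeL2Norm f :=
  Real.sqrt_nonneg _

theorem cubeL2Norm_sq {Y : Type*} [NormedAddCommGroup Y] {m : ℕ} (f : (Fin m → ℤˣ) → Y) :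
    cubeL2Norm f ^ 2 = (1 / 2 ^ m : ℝ) * ∑ t, ‖f t‖ ^ 2 :=
  Real.sq_sqrt (by positivity)

theorem cubeL2Norm_smul {m : ℕ} (c : ℝ) (f : (Fin m → ℤˣ) → X) :
    cubeL2Norm (c • f) = |c| * cubeL2Norm f := by
  rw [cubeL2Norm, cubeL2Norm, ← Real.sqrt_sq_eq_abs, ← Real.sqrt_mul (sq_nonneg c)]
  congr 1
  simp_rw [Pi.smul_apply, norm_smul, mul_pow, Real.norm_eq_abs, sq_abs, ← Finset.mul_sum]
  ring

theorem signCoeff_smul {κ : Type*} [Fintype κ] [DecidableEq κ] (c : ℝ) (f : (κ → ℤˣ) → X) (k : κ) :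
    signCoeff (c • f) k = c • signCoeff f k := by
  simp only [signCoeff, Pi.smul_apply, smul_comm _ c, ← Finset.smul_sum]

theorem rademacherProj_smul {m : ℕ} (c : ℝ) (f : (Fin m → ℤˣ) → X) :
    rademacherProj m (c • f) = c • rademacherProj m f := by
  ext t
  simp only [rademacherProj_apply, Pi.smul_apply, signCoeff_smul, smul_comm _ c,
    ← Finset.smul_sum]

/-- The Rademacher projection is bounded by `‖Rad‖_X`, when the latter is finite. -/
theorem cubeL2Norm_rademacherProj_le (hX : rademacherConst X ≠ ∞) {m : ℕ}
    (f : (Fin m → ℤˣ) → X) :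
    cubeL2Norm (rademacherProj m f) ≤ (rademacherConst X).toReal * cubeL2Norm f := by
  have key : ∀ g : (Fin m → ℤˣ) → X, cubeL2Norm g ≤ 1 →
      cubeL2Norm (rademacherProj m g) ≤ (rademacherConst X).toReal := by
    intro g hg
    rw [← ENNReal.ofReal_le_iff_le_toReal hX]
    exact le_iSup_of_le m (le_iSup_of_le g (le_iSup_of_le hg le_rfl))
  rcases (cubeL2Norm_nonneg f).eq_or_lt with h | h
  -- The supremum runs over the unit ball, so f has to be normalized; a function of norm zero is
  -- treated apart.
  · have hf : f = 0 := by
      have h' := cubeL2Norm_sq f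
      rw [← h] at h'
      have h0 : ∑ t, ‖f t‖ ^ 2 = 0 := by
        rcases mul_eq_zero.1 (h'.symm.trans (by simp)) with h1 | h1
        · exact absurd h1 (by positivity)
        · exact h1
      ext t
      have := (Finset.sum_eq_zero_iff_of_nonneg (fun t _ => by positivity)).1 h0 t
        (Finset.mem_univ _)
      simpa using this
    have : rademacherProj m f = 0 := by
      have := rademacherProj_smul (0 : ℝ) f
      simpa [hf] using this
    rw [this, hf]
    simp [cubeL2Norm]
  · have := key ((cubeL2Norm f)⁻¹ • f) (by
      rw [cubeL2Norm_smul, abs_of_pos (inv_pos.2 h), inv_mul_cancel₀ h.ne'])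
    rw [rademacherProj_smul, cubeL2Norm_smul, abs_of_pos (inv_pos.2 h), inv_mul_le_iff₀ h] at this
    linarith

/-- An enumeration of κ reduces this to `Fin m`. The generality serves the sign arrays indexed by `ι
× Fin N` below. -/
theorem sum_norm_sq_signProj_le_rademacherConst (hX : rademacherConst X ≠ ∞)
    {κ : Type*} [Fintype κ] [DecidableEq κ] (f : (κ → ℤˣ) → X) :
    ∑ t : κ → ℤˣ, ‖∑ k, ((t k : ℤ) : ℝ) • signCoeff f k‖ ^ 2 ≤
      (rademacherConst X).toReal ^ 2 * ∑ t, ‖f t‖ ^ 2 := by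
  have fin : ∀ (m : ℕ) (g : (Fin m → ℤˣ) → X),
      ∑ t : Fin m → ℤˣ, ‖∑ k, ((t k : ℤ) : ℝ) • signCoeff g k‖ ^ 2 ≤
      (rademacherConst X).toReal ^ 2 * ∑ t, ‖g t‖ ^ 2 := by
    intro m g
    have h := pow_le_pow_left₀ (cubeL2Norm_nonneg _) (cubeL2Norm_rademacherProj_le hX g) 2
    rw [mul_pow, cubeL2Norm_sq, cubeL2Norm_sq] at h
    simp_rw [rademacherProj_apply] at h
    have h2 : (0 : ℝ) < 1 / 2 ^ m := by positivity
    refine le_of_mul_le_mul_left ?_ h2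
    linarith
  let e := Fintype.equivFin κ
  let E : (κ → ℤˣ) ≃ (Fin (Fintype.card κ) → ℤˣ) := e.arrowCongr (Equiv.refl _)
  have hE : ∀ t k, E t (e k) = t k := by
    intro t k
    simp [E]
  have hco : ∀ k, signCoeff (f ∘ E.symm) (e k) = signCoeff f k := by
    intro k
    simp only [signCoeff, Fintype.card_fin]
    congr 1
    refine (Fintype.sum_equiv E _ _ fun t => ?_).symm
    simp [hE]
  have h := fin _ (f ∘ E.symm)
  have e1 : ∑ t, ‖(f ∘ E.symm) t‖ ^ 2 = ∑ t, ‖f t‖ ^ 2 :=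
    (Fintype.sum_equiv E _ _ fun t => by simp).symm
  have e2 : ∑ t : Fin (Fintype.card κ) → ℤˣ,
      ‖∑ k, ((t k : ℤ) : ℝ) • signCoeff (f ∘ E.symm) k‖ ^ 2 =
      ∑ t : κ → ℤˣ, ‖∑ k, ((t k : ℤ) : ℝ) • signCoeff f k‖ ^ 2 := by
    refine (Fintype.sum_equiv E _ _ fun t => ?_).symm
    congr 2
    refine Fintype.sum_equiv e _ _ fun k => ?_
    rw [hco, hE]
  rwa [e1, e2] at h

/-- The Rademacher projection constant is bounded by the distance to a Hilbert space. -/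
theorem rademacherConst_ne_top_of_equiv {H : Type*} [NormedAddCommGroup H]
    [InnerProductSpace ℝ H] (T : X →ₗ[ℝ] H) {a b : ℝ} (ha : 0 < a)
    (h1 : ∀ x, a * ‖x‖ ≤ ‖T x‖) (h2 : ∀ x, ‖T x‖ ≤ b * ‖x‖) :
    rademacherConst X ≠ ∞ := by
  refine ne_top_of_le_ne_top (b := ENNReal.ofReal (|b| / a)) ENNReal.ofReal_ne_top ?_
  refine iSup_le fun m => iSup_le fun f => iSup_le fun hf => ENNReal.ofReal_le_ofReal ?_
  refine (pow_le_pow_iff_left₀ (cubeL2Norm_nonneg _) (by positivity) two_ne_zero).1 ?_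
  have hT : ∀ t, T (rademacherProj m f t) = ∑ k, ((t k : ℤ) : ℝ) • signCoeff (T ∘ f) k := by
    intro t
    simp [rademacherProj_apply, signCoeff]
  have hB := sum_norm_sq_signProj_le (T ∘ f)
  simp_rw [← hT] at hB
  have hl : a ^ 2 * ∑ t, ‖rademacherProj m f t‖ ^ 2 ≤
      ∑ t, ‖T (rademacherProj m f t)‖ ^ 2 := by
    rw [Finset.mul_sum]
    refine Finset.sum_le_sum fun t _ => ?_
    rw [← mul_pow]
    exact pow_le_pow_left₀ (by positivity) (h1 _) 2
  have hr : ∑ t, ‖(T ∘ f) t‖ ^ 2 ≤ b ^ 2 * ∑ t, ‖f t‖ ^ 2 := by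
    rw [Finset.mul_sum]
    refine Finset.sum_le_sum fun t _ => ?_
    rw [← mul_pow]
    exact pow_le_pow_left₀ (by positivity) (h2 _) 2
  have hf2 : cubeL2Norm f ^ 2 ≤ 1 := pow_le_one₀ (cubeL2Norm_nonneg f) hf
  rw [cubeL2Norm_sq] at hf2 ⊢
  rw [div_pow, sq_abs, le_div_iff₀ (by positivity)]
  calc _ = (1 / 2 ^ m) * (a ^ 2 * ∑ t, ‖rademacherProj m f t‖ ^ 2) := by ring
    _ ≤ (1 / 2 ^ m) * (b ^ 2 * ∑ t, ‖f t‖ ^ 2) :=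
      mul_le_mul_of_nonneg_left (by linarith) (by positivity)
    _ = b ^ 2 * (1 / 2 ^ m * ∑ t, ‖f t‖ ^ 2) := by ring
    _ ≤ b ^ 2 * 1 := mul_le_mul_of_nonneg_left hf2 (by positivity)
    _ = _ := by ring

end RademacherConst

/-! ### Gaussian approximation by normalized sums of signs -/

section SignSum

open ProbabilityTheory Filter Topology

variable {ι : Type*} [Fintype ι] [DecidableEq ι]

/-- The vector whose `i`-th coordinate is the normalized sum of the signs `t (i, j)`. -/
def signSum (N : ℕ) (t : ι × Fin N → ℤˣ) : EuclideanSpace ℝ ι :=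
  WithLp.toLp 2 fun i => (√N)⁻¹ * ∑ j, ((t (i, j) : ℤ) : ℝ)

/-- The uniform distribution on a finite family of points indexed by signs. -/
def signLaw {κ Y : Type*} [Fintype κ] [DecidableEq κ] [MeasurableSpace Y] (G : (κ → ℤˣ) → Y) :
    Measure Y :=
  ((2 : ℝ≥0∞) ^ Fintype.card κ)⁻¹ • ∑ t, Measure.dirac (G t)

section SignLaw

variable {κ Y : Type*} [Fintype κ] [DecidableEq κ] [MeasurableSpace Y] (G : (κ → ℤˣ) → Y)

instance : IsProbabilityMeasure (signLaw G) where
  measure_univ := by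
    simp [signLaw, Fintype.card_pi, ENNReal.inv_mul_cancel]

theorem integral_signLaw [MeasurableSingletonClass Y] {F : Type*} [NormedAddCommGroup F]
    [NormedSpace ℝ F] [CompleteSpace F] (f : Y → F) :
    ∫ x, f x ∂(signLaw G) = (1 / 2 ^ Fintype.card κ : ℝ) • ∑ t, f (G t) := by
  rw [signLaw, integral_smul_measure, integral_finsetSum_measure]
  · simp
  · intro t _
    exact integrable_dirac (by simp)

theorem lintegral_signLaw [MeasurableSingletonClass Y] (f : Y → ℝ) (hf : ∀ x, 0 ≤ f x) :
    ∫⁻ x, ENNReal.ofReal (f x) ∂(signLaw G) =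
      ENNReal.ofReal ((1 / 2 ^ Fintype.card κ : ℝ) * ∑ t, f (G t)) := by
  rw [signLaw, lintegral_smul_measure, lintegral_finsetSum_measure,
    ENNReal.ofReal_mul (by positivity), ENNReal.ofReal_sum_of_nonneg (fun t _ => hf _)]
  simp [ENNReal.ofReal_inv_of_pos, ENNReal.ofReal_pow]

end SignLaw

/-- The second moment does not depend on N; this yields compactness of the covariance operators and
control of the error terms in the limit. -/
theorem sum_norm_sq_signSum {N : ℕ} (hN : 0 < N) :
    (1 / 2 ^ Fintype.card (ι × Fin N) : ℝ) * ∑ t : ι × Fin N → ℤˣ, ‖signSum N t‖ ^ 2 =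
      Fintype.card ι := by
  have hN' : (0 : ℝ) < N := by exact_mod_cast hN
  have h : ∀ i : ι, ∑ t : ι × Fin N → ℤˣ, (signSum N t i) ^ 2 =
      2 ^ Fintype.card (ι × Fin N) := by
    intro i
    have : ∀ t : ι × Fin N → ℤˣ, (signSum N t i) ^ 2 =
        (N : ℝ)⁻¹ * ∑ j, ∑ k, ((t (i, j) : ℤ) : ℝ) * ((t (i, k) : ℤ) : ℝ) := by
      intro t
      simp only [signSum, mul_pow, inv_pow, Real.sq_sqrt hN'.le]
      rw [sq, Finset.sum_mul_sum]
    simp_rw [this]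
    rw [← Finset.mul_sum, Finset.sum_comm]
    have h2 : ∀ j : Fin N, ∑ t : ι × Fin N → ℤˣ, ∑ k, ((t (i, j) : ℤ) : ℝ) * ((t (i, k) : ℤ) : ℝ)
        = 2 ^ Fintype.card (ι × Fin N) := by
      intro j
      rw [Finset.sum_comm]
      simp_rw [sum_sign_mul_sign]
      simp
    simp_rw [h2]
    simp only [Finset.sum_const, Finset.card_univ, Fintype.card_fin, nsmul_eq_mul]
    field_simp
  simp_rw [EuclideanSpace.real_norm_sq_eq]
  rw [Finset.sum_comm]
  simp_rw [h]
  simp only [Finset.sum_const, Finset.card_univ, nsmul_eq_mul]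
  field_simp

/-- The uniform distribution on `{-1, 1}`, as a measure on `ℝ`. -/
def signMeasure : Measure ℝ := signLaw fun t : Unit → ℤˣ => ((t () : ℤ) : ℝ)

instance : IsProbabilityMeasure signMeasure := by unfold signMeasure; infer_instance

theorem integral_signMeasure {F : Type*} [NormedAddCommGroup F] [NormedSpace ℝ F]
    [CompleteSpace F] (f : ℝ → F) :
    ∫ x, f x ∂signMeasure = (1 / 2 : ℝ) • ∑ u : ℤˣ, f ((u : ℤ) : ℝ) := by
  rw [signMeasure, integral_signLaw]
  simp only [Fintype.card_unit, pow_one]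
  congr 1

/-- Independence of the signs: the exponential factors over the array entries, and the average of
the product is the product of the averages. -/
theorem charFun_signSum (N : ℕ) (s : EuclideanSpace ℝ ι) :
    charFun (signLaw (signSum (ι := ι) N)) s =
      ∏ i, (charFun signMeasure ((√N)⁻¹ * s i)) ^ N := by
  have h : ∀ (x : ℝ), charFun signMeasure x =
      (1 / 2 : ℂ) * ∑ u : ℤˣ, Complex.exp ((((u : ℤ) : ℝ) * x : ℝ) * Complex.I) := by
    intro x
    rw [charFun_apply, integral_signMeasure]
    simp [mul_comm x, mul_add]
  have h3 : ∀ t : ι × Fin N → ℤˣ, Complex.exp ((inner ℝ (signSum N t) s : ℝ) * Complex.I) =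
      ∏ k : ι × Fin N, Complex.exp ((((t k : ℤ) : ℝ) * ((√N)⁻¹ * s k.1) : ℝ) * Complex.I) := by
    intro t
    rw [← Complex.exp_sum]
    congr 1
    rw [← Finset.sum_mul, ← Complex.ofReal_sum, Fintype.sum_prod_type]
    congr 2
    simp only [signSum, PiLp.inner_apply, ← Finset.sum_mul]
    refine Finset.sum_congr rfl fun i _ => ?_
    simp
    ring
  rw [charFun_apply, integral_signLaw]
  simp_rw [h3]
  rw [← Fintype.prod_sum (fun (k : ι × Fin N) (u : ℤˣ) =>
    Complex.exp ((((u : ℤ) : ℝ) * ((√N)⁻¹ * s k.1) : ℝ) * Complex.I))]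
  have h4 : ∏ i, (charFun signMeasure ((√N)⁻¹ * s i)) ^ N =
      ∏ k : ι × Fin N, charFun signMeasure ((√N)⁻¹ * s k.1) := by
    rw [Fintype.prod_prod_type]
    simp
  rw [h4]
  simp_rw [h]
  rw [Finset.prod_mul_distrib, Finset.prod_const, Finset.card_univ]
  simp

variable (ι) in
/-- The law of the normalized sum of signs. -/
def signSumLaw (N : ℕ) : ProbabilityMeasure (EuclideanSpace ℝ ι) :=
  ⟨signLaw (signSum N), inferInstance⟩

variable (ι) in
/-- The standard Gaussian law. -/
def gaussianLaw : ProbabilityMeasure (EuclideanSpace ℝ ι) :=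
  ⟨stdGaussian (EuclideanSpace ℝ ι), inferInstance⟩

/-- The **central limit theorem** for normalized sums of sign vectors. -/
theorem tendsto_signSum :
    Tendsto (signSumLaw ι) atTop (𝓝 (gaussianLaw ι)) := by
  rw [ProbabilityMeasure.tendsto_iff_tendsto_charFun]
  intro s
  change Tendsto (fun N => charFun (signLaw (signSum N)) s) atTop
    (𝓝 (charFun (stdGaussian (EuclideanSpace ℝ ι)) s))
  simp_rw [charFun_signSum, charFun_stdGaussian]
  have h : Complex.exp (-(‖s‖ : ℂ) ^ 2 / 2) = ∏ i, Complex.exp (-(s i : ℂ) ^ 2 / 2) := by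
    rw [← Complex.exp_sum, ← Complex.ofReal_pow, EuclideanSpace.real_norm_sq_eq]
    congr 1
    push_cast
    rw [← Finset.sum_div, Finset.sum_neg_distrib]
  rw [h]
  refine tendsto_finsetProd _ fun i _ => ?_
  have := tendsto_charFun_inv_sqrt_mul_pow (P := signMeasure) (X := id) aemeasurable_id
    (by simp [integral_signMeasure]) (by norm_num [integral_signMeasure]) (s i)
  simpa using this

/-- If the averages of `f` over sign sums converge along a subsequence, the limit bounds the
Gaussian average. -/
theorem integral_stdGaussian_le_of_tendsto {f : EuclideanSpace ℝ ι → ℝ} (hf : Continuous f)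
    (hf0 : 0 ≤ f) {φ : ℕ → ℕ} (hφ : StrictMono φ) {b : ℕ → ℝ} {c : ℝ} (hc : Tendsto b atTop (𝓝 c))
    (hb : ∀ N, (1 / 2 ^ Fintype.card (ι × Fin (φ N)) : ℝ) *
          ∑ t : ι × Fin (φ N) → ℤˣ, f (signSum (φ N) t) ≤ b N) :
    ∫ x, f x ∂(stdGaussian (EuclideanSpace ℝ ι)) ≤ c := by
  have hb0 : ∀ N, 0 ≤ b N := fun N => le_trans
    (mul_nonneg (by positivity) (Finset.sum_nonneg fun t _ => hf0 _)) (hb N)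
  have hc0 : 0 ≤ c := ge_of_tendsto' hc hb0
  rw [integral_eq_lintegral_of_nonneg_ae (Eventually.of_forall hf0)
    hf.aestronglyMeasurable]
  refine ENNReal.toReal_le_of_le_ofReal hc0 ?_
  -- Since f may be unbounded, weak convergence gives only lower semicontinuity of the integral,
  -- which is the direction required; no uniform integrability enters.
  have hlsc := lintegral_le_liminf_lintegral_of_forall_isOpen_measure_le_liminf_measure hf hf0
    (μ := (gaussianLaw ι : Measure (EuclideanSpace ℝ ι)))
    (μs := fun N => (signSumLaw ι (φ N) : Measure (EuclideanSpace ℝ ι)))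
    (fun G hG => ProbabilityMeasure.le_liminf_measure_open_of_tendsto
      ((tendsto_signSum (ι := ι)).comp hφ.tendsto_atTop) hG)
  have this : ∫⁻ x, ENNReal.ofReal (f x) ∂(stdGaussian (EuclideanSpace ℝ ι)) ≤
      atTop.liminf fun N => ∫⁻ x, ENNReal.ofReal (f x) ∂(signLaw (signSum (ι := ι) (φ N))) := hlsc
  simp only [lintegral_signLaw _ f hf0] at this
  refine this.trans ?_
  have hlim : Tendsto (fun N => ENNReal.ofReal (b N)) atTop (𝓝 (ENNReal.ofReal c)) :=
    (ENNReal.continuous_ofReal.tendsto c).comp hc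
  rw [← hlim.liminf_eq]
  exact liminf_le_liminf (Eventually.of_forall fun N => ENNReal.ofReal_le_ofReal (hb N))

end SignSum

/-! ### The standard Gaussian measure -/

section Gaussian

open ProbabilityTheory Filter Topology

variable {ι : Type*} [Fintype ι]

/-- The Gaussian density as a function of the distance to the origin. -/
def gaussianProfile (d : ℕ) (r : ℝ) : ℝ :=
  ((2 * Real.pi) ^ ((d : ℝ) / 2))⁻¹ * Real.exp (-(1 / 2) * r ^ 2)

theorem gaussianProfile_nonneg (d : ℕ) (r : ℝ) : 0 ≤ gaussianProfile d r := by
  unfold gaussianProfile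
  positivity

theorem gaussianProfile_le (d : ℕ) (r : ℝ) :
    gaussianProfile d r ≤ ((2 * Real.pi) ^ ((d : ℝ) / 2))⁻¹ := by
  unfold gaussianProfile
  refine mul_le_of_le_one_right (by positivity) (Real.exp_le_one_iff.2 ?_)
  nlinarith [sq_nonneg r]

theorem continuous_gaussianProfile (d : ℕ) : Continuous (gaussianProfile d) := by
  unfold gaussianProfile
  fun_prop

theorem integrable_gaussianProfile_norm :
    Integrable fun x : EuclideanSpace ℝ ι => gaussianProfile (Fintype.card ι) ‖x‖ := by
  have h := (GaussianFourier.integrable_cexp_neg_mul_sq_norm_add (V := EuclideanSpace ℝ ι)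
    (b := 1 / 2) (by norm_num) 0 0).re
  refine Integrable.const_mul (c := ((2 * Real.pi) ^ ((Fintype.card ι : ℝ) / 2))⁻¹)
    (h.congr (ae_of_all _ fun x => ?_))
  have : (-(1 / 2 : ℂ) * (‖x‖ : ℂ) ^ 2 + 0 * ((inner ℝ (0 : EuclideanSpace ℝ ι) x : ℝ) : ℂ)) =
    ((-(1 / 2) * ‖x‖ ^ 2 : ℝ) : ℂ) := by push_cast; ring
  simp only [this, ← Complex.ofReal_exp]
  exact Complex.ofReal_re _

/-- The standard Gaussian measure has the usual density. -/
theorem stdGaussian_eq_withDensity :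
    stdGaussian (EuclideanSpace ℝ ι) =
      (volume : Measure (EuclideanSpace ℝ ι)).withDensity
        fun x => ENNReal.ofReal (gaussianProfile (Fintype.card ι) ‖x‖) := by
  have : IsFiniteMeasure ((volume : Measure (EuclideanSpace ℝ ι)).withDensity
        fun x => ENNReal.ofReal (gaussianProfile (Fintype.card ι) ‖x‖)) :=
    isFiniteMeasure_withDensity_ofReal integrable_gaussianProfile_norm.2
  refine Measure.ext_of_charFun ?_
  ext s
  rw [charFun_stdGaussian, charFun_apply, integral_withDensity_eq_integral_toReal_smul
    (by have := continuous_gaussianProfile (Fintype.card ι); fun_prop) (by simp)]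
  have h := GaussianFourier.integral_cexp_neg_mul_sq_norm_add (V := EuclideanSpace ℝ ι)
    (b := 1 / 2) (by norm_num) Complex.I s
  have hpos : (0 : ℝ) < (2 * Real.pi) ^ ((Fintype.card ι : ℝ) / 2) := by positivity
  have e1 : ∀ x : EuclideanSpace ℝ ι,
      (ENNReal.ofReal (gaussianProfile (Fintype.card ι) ‖x‖)).toReal •
        Complex.exp ((inner ℝ x s : ℝ) * Complex.I) =
      ((((2 * Real.pi) ^ ((Fintype.card ι : ℝ) / 2))⁻¹ : ℝ) : ℂ) *
        Complex.exp (-(1 / 2 : ℂ) * (‖x‖ : ℂ) ^ 2 + Complex.I * ((inner ℝ s x : ℝ) : ℂ)) := by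
    intro x
    rw [ENNReal.toReal_ofReal (gaussianProfile_nonneg _ _), gaussianProfile, Complex.real_smul,
      Complex.exp_add, real_inner_comm]
    push_cast
    ring_nf
  simp_rw [e1]
  rw [integral_const_mul, h]
  have e2 : ((Real.pi : ℂ) / (1 / 2)) ^ ((Module.finrank ℝ (EuclideanSpace ℝ ι) : ℂ) / 2) =
      (((2 * Real.pi) ^ ((Fintype.card ι : ℝ) / 2) : ℝ) : ℂ) := by
    rw [Complex.ofReal_cpow (by positivity)]
    simp only [finrank_euclideanSpace]
    push_cast
    ring_nf
  rw [e2, ← mul_assoc, ← Complex.ofReal_mul, inv_mul_cancel₀ hpos.ne', Complex.I_sq]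
  push_cast
  ring_nf

theorem integral_stdGaussian (f : EuclideanSpace ℝ ι → ℝ) :
    ∫ x, f x ∂(stdGaussian (EuclideanSpace ℝ ι)) =
      ∫ x, gaussianProfile (Fintype.card ι) ‖x‖ * f x := by
  rw [stdGaussian_eq_withDensity, integral_withDensity_eq_integral_toReal_smul
    (by have := continuous_gaussianProfile (Fintype.card ι); fun_prop) (by simp)]
  refine integral_congr_ae (ae_of_all _ fun x => ?_)
  simp [ENNReal.toReal_ofReal (gaussianProfile_nonneg _ _)]

/-- The density is largest at the origin. -/
theorem stdGaussian_le_volume (s : Set (EuclideanSpace ℝ ι)) (hs : MeasurableSet s) :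
    stdGaussian (EuclideanSpace ℝ ι) s ≤
      ENNReal.ofReal ((2 * Real.pi) ^ ((Fintype.card ι : ℝ) / 2))⁻¹ * volume s := by
  rw [stdGaussian_eq_withDensity, withDensity_apply _ hs, ← setLIntegral_const]
  exact lintegral_mono fun x => ENNReal.ofReal_le_ofReal (gaussianProfile_le _ _)

/-- Polar coordinates for positively homogeneous functions. -/
theorem integral_stdGaussian_of_homogeneous_aux [Nonempty ι] {f : EuclideanSpace ℝ ι → ℝ}
    (hf : ∀ (r : ℝ), 0 < r → ∀ x, f (r • x) = r * f x) :
    ∫ x, f x ∂(stdGaussian (EuclideanSpace ℝ ι)) =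
      (∫ x : Metric.sphere (0 : EuclideanSpace ℝ ι) 1, f x
        ∂((volume : Measure (EuclideanSpace ℝ ι)).toSphere)) *
      ∫ r : Set.Ioi (0 : ℝ), gaussianProfile (Fintype.card ι) r * r
        ∂(Measure.volumeIoiPow (Module.finrank ℝ (EuclideanSpace ℝ ι) - 1)) := by
  rw [integral_stdGaussian, ← integral_prod_mul (μ := (volume :
    Measure (EuclideanSpace ℝ ι)).toSphere) (fun x => f x)
    (fun r : Set.Ioi (0 : ℝ) => gaussianProfile (Fintype.card ι) r * (r : ℝ)),
    ← (volume : Measure (EuclideanSpace ℝ ι)).measurePreserving_homeomorphUnitSphereProd.integral_comp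
      (Homeomorph.measurableEmbedding _),
    ← restrict_compl_singleton (μ := (volume : Measure (EuclideanSpace ℝ ι))) 0,
    ← integral_subtype_comap (measurableSet_singleton _).compl
      fun x : EuclideanSpace ℝ ι => gaussianProfile (Fintype.card ι) ‖x‖ * f x,
    restrict_compl_singleton]
  refine integral_congr_ae (ae_of_all _ fun x => ?_)
  have hx : 0 < ‖(x : EuclideanSpace ℝ ι)‖ := norm_pos_iff.2 x.2
  simp only [homeomorphUnitSphereProd_apply_fst_coe, homeomorphUnitSphereProd_apply_snd_coe]
  -- By homogeneity f x = ‖x‖ f (x/‖x‖), so the integrand splits into a spherical and a radial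
  -- factor.
  rw [hf _ (inv_pos.2 hx)]
  field_simp

/-- The Gaussian average of a homogeneous function is a multiple of its spherical average. -/
theorem integral_stdGaussian_of_homogeneous [Nonempty ι] {f : EuclideanSpace ℝ ι → ℝ}
    (hf : ∀ (r : ℝ), 0 < r → ∀ x, f (r • x) = r * f x) :
    ∫ x, f x ∂(stdGaussian (EuclideanSpace ℝ ι)) =
      (∫ x, ‖x‖ ∂(stdGaussian (EuclideanSpace ℝ ι))) *
      ⨍ x : Metric.sphere (0 : EuclideanSpace ℝ ι) 1, f x
        ∂((volume : Measure (EuclideanSpace ℝ ι)).toSphere) := by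
  rw [integral_stdGaussian_of_homogeneous_aux hf,
    integral_stdGaussian_of_homogeneous_aux (f := fun x => ‖x‖)
    (fun r hr x => by rw [norm_smul, Real.norm_of_nonneg hr.le]), average_eq]
  -- The radial integral is common to f and to the norm, and the norm is 1 on the sphere; only the
  -- total mass of the sphere must be divided out.
  have h0 : (volume : Measure (EuclideanSpace ℝ ι)).toSphere.real Set.univ ≠ 0 := by
    rw [Measure.toSphere_real_apply_univ]
    refine mul_ne_zero (by simp) ?_
    exact (ENNReal.toReal_pos (Metric.measure_ball_pos _ _ one_pos).ne'
      measure_ball_lt_top.ne).ne'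
  simp only [mem_sphere_zero_iff_norm.1 (Subtype.prop _), integral_const, smul_eq_mul, mul_one]
  field_simp

theorem measurePreserving_coord_stdGaussian (i : ι) :
    MeasurePreserving (fun x : EuclideanSpace ℝ ι => x i) (stdGaussian (EuclideanSpace ℝ ι))
      (gaussianReal 0 1) := by
  refine ⟨by fun_prop, ?_⟩
  rw [← map_pi_eq_stdGaussian, Measure.map_map (by fun_prop) (by fun_prop)]
  exact (measurePreserving_eval (fun _ : ι => gaussianReal 0 1) i).map_eq

theorem memLp_norm_stdGaussian :
    MemLp (fun x : EuclideanSpace ℝ ι => ‖x‖) 2 (stdGaussian (EuclideanSpace ℝ ι)) :=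
  (IsGaussian.memLp_two_id (μ := stdGaussian (EuclideanSpace ℝ ι))).norm

theorem integral_abs_gaussianReal : ∫ x, |x| ∂(gaussianReal 0 1) = √(2 / Real.pi) := by
  rw [integral_gaussianReal_eq_integral_smul one_ne_zero]
  have e : ∀ x : ℝ, gaussianPDFReal 0 1 x • |x| =
      (fun y => (√(2 * Real.pi))⁻¹ * (y ^ (1 : ℝ) * Real.exp (-(1 / 2) * y ^ (2 : ℝ)))) |x| := by
    intro x
    simp [gaussianPDFReal]
    ring_nf
  simp_rw [e]
  rw [integral_comp_abs (f := fun y : ℝ =>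
    (√(2 * Real.pi))⁻¹ * (y ^ (1 : ℝ) * Real.exp (-(1 / 2) * y ^ (2 : ℝ)))), integral_const_mul,
    _root_.integral_rpow_mul_exp_neg_mul_rpow two_pos (by norm_num) (by norm_num)]
  have h1 : (-((1 : ℝ) + 1) / 2) = -1 := by norm_num
  have h2 : (((1 : ℝ) + 1) / 2) = 1 := by norm_num
  rw [h1, h2, Real.Gamma_one, Real.rpow_neg_one]
  have h3 : √(2 / Real.pi) = 2 * (√(2 * Real.pi))⁻¹ := by
    rw [← Real.sqrt_inv, Real.sqrt_eq_iff_mul_self_eq (by positivity) (by positivity),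
      mul_mul_mul_comm, Real.mul_self_sqrt (by positivity)]
    field_simp
  rw [h3]
  norm_num

theorem integral_abs_coord_stdGaussian (i : ι) :
    ∫ x : EuclideanSpace ℝ ι, |x i| ∂(stdGaussian (EuclideanSpace ℝ ι)) = √(2 / Real.pi) := by
  rw [← integral_abs_gaussianReal, ← (measurePreserving_coord_stdGaussian i).map_eq,
    integral_map (by fun_prop) (by fun_prop)]

theorem integral_norm_sq_stdGaussian :
    ∫ x : EuclideanSpace ℝ ι, ‖x‖ ^ 2 ∂(stdGaussian (EuclideanSpace ℝ ι)) = Fintype.card ι := by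
  have h1 : ∫ x, x ^ 2 ∂(gaussianReal 0 1) = 1 := by
    have := variance_fun_id_gaussianReal (μ := 0) (v := 1)
    rw [variance_eq_integral (by fun_prop)] at this
    simpa using this
  have hi : Integrable (fun x : ℝ => x ^ 2) (gaussianReal 0 1) :=
    (memLp_id_gaussianReal 2).integrable_sq
  simp_rw [EuclideanSpace.real_norm_sq_eq]
  rw [integral_finsetSum]
  · have : ∀ i : ι, ∫ x : EuclideanSpace ℝ ι, x i ^ 2 ∂(stdGaussian (EuclideanSpace ℝ ι)) = 1 := by
      intro i
      rw [← h1, ← (measurePreserving_coord_stdGaussian i).map_eq,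
        integral_map (by fun_prop) (by fun_prop)]
    simp [this]
  · intro i _
    exact (measurePreserving_coord_stdGaussian i).integrable_comp_of_integrable hi

theorem integrable_norm_stdGaussian :
    Integrable (fun x : EuclideanSpace ℝ ι => ‖x‖) (stdGaussian (EuclideanSpace ℝ ι)) :=
  memLp_norm_stdGaussian.integrable (by norm_num)

theorem integral_norm_stdGaussian_le :
    ∫ x : EuclideanSpace ℝ ι, ‖x‖ ∂(stdGaussian (EuclideanSpace ℝ ι)) ≤ √(Fintype.card ι) := by
  refine Real.le_sqrt_of_sq_le ?_
  rw [← integral_norm_sq_stdGaussian]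
  have := variance_nonneg (fun x : EuclideanSpace ℝ ι => ‖x‖) (stdGaussian (EuclideanSpace ℝ ι))
  rw [variance_eq_sub memLp_norm_stdGaussian] at this
  simpa using this

/-- By Cauchy–Schwarz ‖x‖ is at least the ℓ¹ norm divided by √d, and each coordinate has absolute
mean √(2/π). -/
theorem le_integral_norm_stdGaussian [Nonempty ι] :
    √(2 / Real.pi) * √(Fintype.card ι) ≤
      ∫ x : EuclideanSpace ℝ ι, ‖x‖ ∂(stdGaussian (EuclideanSpace ℝ ι)) := by
  have hd : (0 : ℝ) < Fintype.card ι := by exact_mod_cast Fintype.card_pos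
  have key : ∀ x : EuclideanSpace ℝ ι, (√(Fintype.card ι))⁻¹ * ∑ i, |x i| ≤ ‖x‖ := by
    intro x
    rw [inv_mul_le_iff₀ (by positivity)]
    have := Finset.sum_mul_sq_le_sq_mul_sq Finset.univ (fun _ : ι => (1 : ℝ)) (fun i => |x i|)
    refine (pow_le_pow_iff_left₀ (by positivity) (by positivity) two_ne_zero).1 ?_
    rw [mul_pow, Real.sq_sqrt hd.le, EuclideanSpace.real_norm_sq_eq]
    simpa using this
  have hint : ∀ i : ι, Integrable (fun x : EuclideanSpace ℝ ι => |x i|)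
      (stdGaussian (EuclideanSpace ℝ ι)) := by
    intro i
    refine integrable_norm_stdGaussian.mono (by fun_prop) (ae_of_all _ fun x => ?_)
    simpa using PiLp.norm_apply_le x i
  calc √(2 / Real.pi) * √(Fintype.card ι)
      = ∫ x : EuclideanSpace ℝ ι, (√(Fintype.card ι))⁻¹ * ∑ i, |x i|
          ∂(stdGaussian (EuclideanSpace ℝ ι)) := by
        rw [integral_const_mul, integral_finsetSum _ (fun i _ => hint i)]
        simp_rw [integral_abs_coord_stdGaussian]
        simp only [Finset.sum_const, Finset.card_univ, nsmul_eq_mul]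
        have : (Fintype.card ι : ℝ) = √(Fintype.card ι) * √(Fintype.card ι) :=
          (Real.mul_self_sqrt hd.le).symm
        have h2 : √(Fintype.card ι : ℝ) ≠ 0 := by positivity
        field_simp
        rw [Real.sq_sqrt hd.le]
    _ ≤ _ := integral_mono ((integrable_finsetSum _ fun i _ => hint i).const_mul _)
        integrable_norm_stdGaussian key

end Gaussian

/-! ### Support functions -/

section Support

open ProbabilityTheory Filter Topology

variable {ι : Type*} [Fintype ι]

/-- The support function `h_A(x) = sup {⟨x, y⟩ : y ∈ A}`. -/
def supportFun (A : Set (EuclideanSpace ℝ ι)) (x : EuclideanSpace ℝ ι) : ℝ :=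
  sSup ((fun y => inner ℝ x y) '' A)

/-- A nonempty bounded symmetric set. -/
structure IsSymmBounded (A : Set (EuclideanSpace ℝ ι)) : Prop where
  nonempty : A.Nonempty
  bounded : Bornology.IsBounded A
  neg_mem : ∀ x ∈ A, -x ∈ A

namespace IsSymmBounded

variable {A : Set (EuclideanSpace ℝ ι)} (hA : IsSymmBounded A)

include hA

theorem exists_norm_le : ∃ C : ℝ, 0 ≤ C ∧ ∀ y ∈ A, ‖y‖ ≤ C := by
  obtain ⟨C, hC⟩ := hA.bounded.exists_norm_le
  exact ⟨max C 0, le_max_right _ _, fun y hy => (hC y hy).trans (le_max_left _ _)⟩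

theorem bddAbove (x : EuclideanSpace ℝ ι) : BddAbove ((fun y => inner ℝ x y) '' A) := by
  obtain ⟨C, hC0, hC⟩ := hA.exists_norm_le
  refine ⟨‖x‖ * C, ?_⟩
  rintro _ ⟨y, hy, rfl⟩
  exact (real_inner_le_norm x y).trans (mul_le_mul_of_nonneg_left (hC y hy) (norm_nonneg x))

theorem inner_le {y : EuclideanSpace ℝ ι} (hy : y ∈ A) (x : EuclideanSpace ℝ ι) :
    inner ℝ x y ≤ supportFun A x :=
  le_csSup (hA.bddAbove x) ⟨y, hy, rfl⟩

theorem supportFun_le {x : EuclideanSpace ℝ ι} {c : ℝ} (h : ∀ y ∈ A, inner ℝ x y ≤ c) :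
    supportFun A x ≤ c := by
  refine csSup_le (hA.nonempty.image _) ?_
  rintro _ ⟨y, hy, rfl⟩
  exact h y hy

theorem supportFun_le_iff {x : EuclideanSpace ℝ ι} {c : ℝ} :
    supportFun A x ≤ c ↔ ∀ y ∈ A, inner ℝ x y ≤ c :=
  ⟨fun h _ hy => (hA.inner_le hy x).trans h, hA.supportFun_le⟩

theorem supportFun_nonneg (x : EuclideanSpace ℝ ι) : 0 ≤ supportFun A x := by
  obtain ⟨y, hy⟩ := hA.nonempty
  have h1 := hA.inner_le hy x
  have h2 := hA.inner_le (hA.neg_mem y hy) x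
  rw [inner_neg_right] at h2
  linarith

theorem exists_supportFun_le_mul_norm : ∃ C : ℝ, 0 ≤ C ∧ ∀ x, supportFun A x ≤ C * ‖x‖ := by
  obtain ⟨C, hC0, hC⟩ := hA.exists_norm_le
  refine ⟨C, hC0, fun x => hA.supportFun_le fun y hy => ?_⟩
  rw [mul_comm]
  exact (real_inner_le_norm x y).trans (mul_le_mul_of_nonneg_left (hC y hy) (norm_nonneg x))

theorem supportFun_add_le (x z : EuclideanSpace ℝ ι) :
    supportFun A (x + z) ≤ supportFun A x + supportFun A z := by
  refine hA.supportFun_le fun y hy => ?_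
  rw [inner_add_left]
  exact add_le_add (hA.inner_le hy x) (hA.inner_le hy z)

theorem supportFun_smul {r : ℝ} (hr : 0 < r) (x : EuclideanSpace ℝ ι) :
    supportFun A (r • x) = r * supportFun A x := by
  refine le_antisymm (hA.supportFun_le fun y hy => ?_) ?_
  · rw [real_inner_smul_left]
    exact mul_le_mul_of_nonneg_left (hA.inner_le hy x) hr.le
  · rw [← le_div_iff₀' hr]
    refine hA.supportFun_le fun y hy => ?_
    rw [le_div_iff₀' hr, ← real_inner_smul_left]
    exact hA.inner_le hy _

theorem continuous_supportFun : Continuous (supportFun A) := by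
  obtain ⟨C, hC0, hC⟩ := hA.exists_supportFun_le_mul_norm
  refine (LipschitzWith.of_le_add_mul C.toNNReal fun x y => ?_).continuous
  rw [Real.coe_toNNReal _ hC0, dist_eq_norm]
  have := hA.supportFun_add_le y (x - y)
  rw [add_sub_cancel] at this
  exact this.trans (add_le_add_right (hC _) _)

theorem integrable_supportFun :
    Integrable (supportFun A) (stdGaussian (EuclideanSpace ℝ ι)) := by
  obtain ⟨C, hC0, hC⟩ := hA.exists_supportFun_le_mul_norm
  refine (integrable_norm_stdGaussian.const_mul C).mono
    hA.continuous_supportFun.aestronglyMeasurable (ae_of_all _ fun x => ?_)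
  rw [Real.norm_of_nonneg (hA.supportFun_nonneg x),
    Real.norm_of_nonneg (mul_nonneg hC0 (norm_nonneg x))]
  exact hC x

theorem image (T : EuclideanSpace ℝ ι →ₗ[ℝ] EuclideanSpace ℝ ι) : IsSymmBounded (T '' A) where
  nonempty := hA.nonempty.image _
  bounded := by
    have := hA.bounded.image T.toContinuousLinearMap
    simpa using this
  neg_mem := by
    rintro _ ⟨x, hx, rfl⟩
    exact ⟨-x, hA.neg_mem x hx, map_neg T x⟩

/-- The gauge of the polar body is the support function. -/
theorem gauge_polarBody (x : EuclideanSpace ℝ ι) : gauge (polarBody A) x = supportFun A x := by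
  have h : {r ∈ Set.Ioi (0 : ℝ) | r⁻¹ • x ∈ polarBody A} =
      {r : ℝ | 0 < r ∧ supportFun A x ≤ r} := by
    ext r
    simp only [Set.mem_ofPred_eq, Set.mem_Ioi, polarBody]
    refine and_congr_right fun hr => ?_
    rw [hA.supportFun_le_iff]
    refine forall₂_congr fun y _ => ?_
    rw [real_inner_smul_left, inv_mul_le_iff₀ hr, mul_one]
  rw [gauge_def', h]
  refine le_antisymm (le_of_forall_gt_imp_ge_of_dense fun c hc => ?_) ?_
  · exact csInf_le ⟨0, fun r hr => hr.1.le⟩ ⟨(hA.supportFun_nonneg x).trans_lt hc, hc.le⟩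
  · refine le_csInf ⟨supportFun A x + 1, ?_, ?_⟩ fun r hr => hr.2
    · have := hA.supportFun_nonneg x
      linarith
    · linarith

/-- The Gaussian average of the support function is a multiple of the mean width. -/
theorem integral_supportFun [Nonempty ι] :
    ∫ x, supportFun A x ∂(stdGaussian (EuclideanSpace ℝ ι)) =
      (∫ x, ‖x‖ ∂(stdGaussian (EuclideanSpace ℝ ι))) * meanWidth A := by
  rw [integral_stdGaussian_of_homogeneous fun r hr x => hA.supportFun_smul hr x, meanWidth,
    meanNorm]
  simp_rw [hA.gauge_polarBody]

theorem meanWidth_nonneg [Nonempty ι] : 0 ≤ meanWidth A := by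
  have h := hA.integral_supportFun
  have h1 : 0 ≤ ∫ x, supportFun A x ∂(stdGaussian (EuclideanSpace ℝ ι)) :=
    integral_nonneg hA.supportFun_nonneg
  have h2 := le_integral_norm_stdGaussian (ι := ι)
  have hd : (0 : ℝ) < Fintype.card ι := by exact_mod_cast Fintype.card_pos
  have h3 : 0 < √(2 / Real.pi) * √(Fintype.card ι) := by positivity
  rw [h] at h1
  exact nonneg_of_mul_nonneg_right h1 (h3.trans_le h2)

end IsSymmBounded

/-- Multiplication of the coordinates by signs, as a linear isometry. -/
def signIsometry (t : ι → ℤˣ) : EuclideanSpace ℝ ι ≃ₗᵢ[ℝ] EuclideanSpace ℝ ι :=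
  LinearIsometryEquiv.piLpCongrRight 2 fun i =>
    if t i = 1 then LinearIsometryEquiv.refl ℝ ℝ else LinearIsometryEquiv.neg ℝ

theorem signIsometry_apply (t : ι → ℤˣ) (x : EuclideanSpace ℝ ι) (i : ι) :
    signIsometry t x i = ((t i : ℤ) : ℝ) * x i := by
  rcases Int.units_eq_one_or (t i) with h | h <;> simp [signIsometry, h]

theorem integral_comp_isometry (f : EuclideanSpace ℝ ι → ℝ) (hf : Continuous f)
    (T : EuclideanSpace ℝ ι ≃ₗᵢ[ℝ] EuclideanSpace ℝ ι) :
    ∫ x, f (T x) ∂(stdGaussian (EuclideanSpace ℝ ι)) =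
      ∫ x, f x ∂(stdGaussian (EuclideanSpace ℝ ι)) := by
  have h := stdGaussian_map T
  conv_rhs => rw [← h]
  rw [integral_map T.continuous.aemeasurable hf.aestronglyMeasurable]

theorem integrable_comp_isometry {f : EuclideanSpace ℝ ι → ℝ}
    (hf : Integrable f (stdGaussian (EuclideanSpace ℝ ι)))
    (T : EuclideanSpace ℝ ι ≃ₗᵢ[ℝ] EuclideanSpace ℝ ι) :
    Integrable (fun x => f (T x)) (stdGaussian (EuclideanSpace ℝ ι)) := by
  have h := stdGaussian_map T
  rw [← h] at hf
  exact hf.comp_measurable T.continuous.measurable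

/-- The vector of absolute values of the coordinates. -/
def absVec {ι : Type*} (x : EuclideanSpace ℝ ι) : EuclideanSpace ℝ ι := WithLp.toLp 2 fun i => |x i|

theorem norm_absVec (x : EuclideanSpace ℝ ι) : ‖absVec x‖ = ‖x‖ := by
  simp [EuclideanSpace.norm_eq, absVec]

theorem continuous_absVec {ι : Type*} : Continuous (absVec (ι := ι)) := by
  unfold absVec
  fun_prop

/-- Comparison of sign averages and Gaussian averages. -/
theorem IsSymmBounded.sum_supportFun_sign_le [DecidableEq ι] {A : Set (EuclideanSpace ℝ ι)}
    (hA : IsSymmBounded A) :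
    √(2 / Real.pi) * ∑ t : ι → ℤˣ,
        supportFun A (WithLp.toLp 2 fun i => ((t i : ℤ) : ℝ)) ≤
      2 ^ Fintype.card ι * ∫ x, supportFun A x ∂(stdGaussian (EuclideanSpace ℝ ι)) := by
  set γ := stdGaussian (EuclideanSpace ℝ ι)
  have hc : 0 < √(2 / Real.pi) := by positivity
  have hint : ∀ t : ι → ℤˣ, Integrable (fun x => supportFun A (signIsometry t (absVec x))) γ := by
    intro t
    obtain ⟨C, hC0, hC⟩ := hA.exists_supportFun_le_mul_norm
    refine (integrable_norm_stdGaussian.const_mul C).mono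
      (hA.continuous_supportFun.comp ((signIsometry t).continuous.comp
        continuous_absVec)).aestronglyMeasurable (ae_of_all _ fun x => ?_)
    rw [Real.norm_of_nonneg (hA.supportFun_nonneg _),
      Real.norm_of_nonneg (mul_nonneg hC0 (norm_nonneg x))]
    refine (hC _).trans ?_
    rw [(signIsometry t).norm_map, norm_absVec]
  -- Jensen's inequality: √(2/π) t is the Gaussian mean of the vector with coordinates t i |x i|.
  have hstep : ∀ t : ι → ℤˣ, √(2 / Real.pi) *
      supportFun A (WithLp.toLp 2 fun i => ((t i : ℤ) : ℝ)) ≤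
      ∫ x, supportFun A (signIsometry t (absVec x)) ∂γ := by
    intro t
    rw [← le_div_iff₀' hc]
    refine hA.supportFun_le fun y hy => ?_
    rw [le_div_iff₀' hc]
    have habs : ∀ i : ι, Integrable (fun x : EuclideanSpace ℝ ι => |x i|) γ := by
      intro i
      refine integrable_norm_stdGaussian.mono (by fun_prop) (ae_of_all _ fun x => ?_)
      simpa using PiLp.norm_apply_le x i
    have hexp : ∀ x : EuclideanSpace ℝ ι, inner ℝ (signIsometry t (absVec x)) y =
        ∑ i, (((t i : ℤ) : ℝ) * y i) * |x i| := by
      intro x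
      rw [PiLp.inner_apply]
      refine Finset.sum_congr rfl fun i _ => ?_
      rw [signIsometry_apply]
      simp [absVec]
      ring
    have heq : √(2 / Real.pi) * inner ℝ (WithLp.toLp 2 fun i => ((t i : ℤ) : ℝ)) y =
        ∫ x, inner ℝ (signIsometry t (absVec x)) y ∂γ := by
      simp_rw [hexp]
      rw [integral_finsetSum _ fun i _ => (habs i).const_mul _]
      simp_rw [integral_const_mul]
      rw [PiLp.inner_apply, Finset.mul_sum]
      refine Finset.sum_congr rfl fun i _ => ?_
      rw [integral_abs_coord_stdGaussian]
      simp
      ring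
    rw [heq]
    refine integral_mono ?_ (hint t) fun x => hA.inner_le hy _
    simp_rw [hexp]
    exact integrable_finsetSum _ fun i _ => (habs i).const_mul _
  -- Multiplication by the sign pattern of x permutes the cube, which removes the absolute values;
  -- rotation invariance then makes all the integrals equal.
  have hswap : ∀ x : EuclideanSpace ℝ ι, ∑ t : ι → ℤˣ, supportFun A (signIsometry t (absVec x)) =
      ∑ t : ι → ℤˣ, supportFun A (signIsometry t x) := by
    intro x
    let s : ι → ℤˣ := fun i => if 0 ≤ x i then 1 else -1
    refine Fintype.sum_equiv (Equiv.mulRight s) _ _ fun t => ?_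
    congr 1
    ext i
    rw [signIsometry_apply, signIsometry_apply]
    by_cases hx : 0 ≤ x i
    · simp [s, hx, absVec, abs_of_nonneg hx]
    · simp [s, hx, absVec, abs_of_neg (not_le.1 hx)]
  calc √(2 / Real.pi) * ∑ t : ι → ℤˣ, supportFun A (WithLp.toLp 2 fun i => ((t i : ℤ) : ℝ))
      ≤ ∑ t : ι → ℤˣ, ∫ x, supportFun A (signIsometry t (absVec x)) ∂γ := by
        rw [Finset.mul_sum]
        exact Finset.sum_le_sum fun t _ => hstep t
    _ = ∑ t : ι → ℤˣ, ∫ x, supportFun A (signIsometry t x) ∂γ := by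
        rw [← integral_finsetSum _ fun t _ => hint t,
          ← integral_finsetSum _ fun t _ =>
            integrable_comp_isometry hA.integrable_supportFun (signIsometry t)]
        simp_rw [hswap]
        rfl
    _ = 2 ^ Fintype.card ι * ∫ x, supportFun A x ∂γ := by
        simp_rw [γ, integral_comp_isometry _ hA.continuous_supportFun]
        simp [Fintype.card_pi]

/-- The sign width is dominated by the mean width. -/
theorem IsSymmBounded.signWidth_le [DecidableEq ι] [Nonempty ι] {A : Set (EuclideanSpace ℝ ι)}
    (hA : IsSymmBounded A) :
    signWidth A ≤ (√(2 / Real.pi))⁻¹ * meanWidth A := by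
  have hd : (0 : ℝ) < Fintype.card ι := by exact_mod_cast Fintype.card_pos
  have hs : 0 < √(Fintype.card ι : ℝ) := Real.sqrt_pos.2 hd
  have hc : 0 < √(2 / Real.pi) := by positivity
  have h1 : signWidth A = (1 / 2 ^ Fintype.card ι : ℝ) * ((√(Fintype.card ι))⁻¹ *
      ∑ t : ι → ℤˣ, supportFun A (WithLp.toLp 2 fun i => ((t i : ℤ) : ℝ))) := by
    rw [signWidth]
    congr 1
    rw [Finset.mul_sum]
    refine Finset.sum_congr rfl fun t _ => ?_
    rw [← hA.supportFun_smul (inv_pos.2 hs), supportFun]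
    have hfun : (fun x : EuclideanSpace ℝ ι =>
        ∑ i, (((t i : ℤ) : ℝ) / √(Fintype.card ι)) * x i) =
        fun x => inner ℝ ((√(Fintype.card ι))⁻¹ • WithLp.toLp 2 fun i => ((t i : ℤ) : ℝ)) x := by
      ext x
      rw [PiLp.inner_apply]
      refine Finset.sum_congr rfl fun i _ => ?_
      simp
      ring
    rw [hfun]
  have h2 := hA.sum_supportFun_sign_le
  rw [hA.integral_supportFun] at h2
  have h3 := mul_le_mul_of_nonneg_right (integral_norm_stdGaussian_le (ι := ι)) hA.meanWidth_nonneg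
  have h4 : √(2 / Real.pi) * ∑ t : ι → ℤˣ,
        supportFun A (WithLp.toLp 2 fun i => ((t i : ℤ) : ℝ)) ≤
      2 ^ Fintype.card ι * (√(Fintype.card ι) * meanWidth A) :=
    h2.trans (mul_le_mul_of_nonneg_left h3 (by positivity))
  rw [h1, le_inv_mul_iff₀ hc]
  calc _ = (1 / 2 ^ Fintype.card ι : ℝ) * (√(Fintype.card ι))⁻¹ * (√(2 / Real.pi) *
      ∑ t : ι → ℤˣ, supportFun A (WithLp.toLp 2 fun i => ((t i : ℤ) : ℝ))) := by ring
    _ ≤ (1 / 2 ^ Fintype.card ι : ℝ) * (√(Fintype.card ι))⁻¹ *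
        (2 ^ Fintype.card ι * (√(Fintype.card ι) * meanWidth A)) :=
      mul_le_mul_of_nonneg_left h4 (by positivity)
    _ = meanWidth A := by field_simp

end Support

/-! ### Lewis position for the Gaussian norm -/

section Lewis

open ProbabilityTheory Filter Topology

variable {ι : Type*} [Fintype ι]

/-- The quadratic mean of a function with respect to the standard Gaussian measure. -/
def gaussRMS (f : EuclideanSpace ℝ ι → ℝ) : ℝ :=
  √(∫ x, f x ^ 2 ∂(stdGaussian (EuclideanSpace ℝ ι)))

theorem gaussRMS_nonneg (f : EuclideanSpace ℝ ι → ℝ) : 0 ≤ gaussRMS f := Real.sqrt_nonneg _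

theorem gaussRMS_sq (f : EuclideanSpace ℝ ι → ℝ) :
    gaussRMS f ^ 2 = ∫ x, f x ^ 2 ∂(stdGaussian (EuclideanSpace ℝ ι)) :=
  Real.sq_sqrt (integral_nonneg fun _ => sq_nonneg _)

theorem gaussRMS_norm_mul {C : ℝ} (hC : 0 ≤ C) :
    gaussRMS (fun x : EuclideanSpace ℝ ι => C * ‖x‖) = C * √(Fintype.card ι) := by
  simp_rw [gaussRMS, mul_pow]
  rw [integral_const_mul, integral_norm_sq_stdGaussian, Real.sqrt_mul (sq_nonneg C),
    Real.sqrt_sq hC]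

theorem memLp_of_le_norm {f : EuclideanSpace ℝ ι → ℝ} (hf : Continuous f) {C : ℝ}
    (h0 : ∀ x, 0 ≤ f x) (h : ∀ x, f x ≤ C * ‖x‖) :
    MemLp f 2 (stdGaussian (EuclideanSpace ℝ ι)) := by
  refine (memLp_norm_stdGaussian.const_mul C).mono hf.aestronglyMeasurable
    (ae_of_all _ fun x => ?_)
  rw [Real.norm_of_nonneg (h0 x)]
  exact (h x).trans (le_abs_self _)

theorem gaussRMS_mono {f g : EuclideanSpace ℝ ι → ℝ}
    (hf : MemLp f 2 (stdGaussian (EuclideanSpace ℝ ι)))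
    (hg : MemLp g 2 (stdGaussian (EuclideanSpace ℝ ι))) (h0 : ∀ x, 0 ≤ f x)
    (h : ∀ x, f x ≤ g x) : gaussRMS f ≤ gaussRMS g :=
  Real.sqrt_le_sqrt (integral_mono hf.integrable_sq hg.integrable_sq fun x =>
    pow_le_pow_left₀ (h0 x) (h x) 2)

theorem integral_mul_le_gaussRMS {f g : EuclideanSpace ℝ ι → ℝ}
    (hf : MemLp f 2 (stdGaussian (EuclideanSpace ℝ ι)))
    (hg : MemLp g 2 (stdGaussian (EuclideanSpace ℝ ι))) (h0 : ∀ x, 0 ≤ f x)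
    (h0' : ∀ x, 0 ≤ g x) :
    ∫ x, f x * g x ∂(stdGaussian (EuclideanSpace ℝ ι)) ≤ gaussRMS f * gaussRMS g := by
  have := integral_mul_le_Lp_mul_Lq_of_nonneg (μ := stdGaussian (EuclideanSpace ℝ ι))
    Real.HolderConjugate.two_two (ae_of_all _ h0) (ae_of_all _ h0')
    (by simpa using hf) (by simpa using hg)
  simpa [gaussRMS, Real.sqrt_eq_rpow] using this

/-- **Minkowski's inequality**. -/
theorem gaussRMS_le_add {f g h : EuclideanSpace ℝ ι → ℝ}
    (hf : MemLp f 2 (stdGaussian (EuclideanSpace ℝ ι)))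
    (hg : MemLp g 2 (stdGaussian (EuclideanSpace ℝ ι)))
    (hh : MemLp h 2 (stdGaussian (EuclideanSpace ℝ ι)))
    (hf0 : ∀ x, 0 ≤ f x) (hg0 : ∀ x, 0 ≤ g x) (hh0 : ∀ x, 0 ≤ h x)
    (hle : ∀ x, f x ≤ g x + h x) : gaussRMS f ≤ gaussRMS g + gaussRMS h := by
  refine (gaussRMS_mono hf (hg.add hh) hf0 hle).trans ?_
  refine Real.sqrt_le_iff.2 ⟨add_nonneg (gaussRMS_nonneg _) (gaussRMS_nonneg _), ?_⟩
  have hgh : Integrable (fun x => g x * h x) (stdGaussian (EuclideanSpace ℝ ι)) :=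
    hg.integrable_mul hh
  have e : ∀ x, (g + h) x ^ 2 = g x ^ 2 + 2 * (g x * h x) + h x ^ 2 := by
    intro x
    simp only [Pi.add_apply]
    ring
  simp_rw [e]
  have hi : Integrable (fun x => g x ^ 2 + 2 * (g x * h x))
      (stdGaussian (EuclideanSpace ℝ ι)) := hg.integrable_sq.add (hgh.const_mul 2)
  rw [integral_add hi hh.integrable_sq,
    integral_add hg.integrable_sq (hgh.const_mul 2), integral_const_mul, ← gaussRMS_sq,
    ← gaussRMS_sq]
  have := integral_mul_le_gaussRMS hg hh hg0 hh0
  nlinarith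

theorem gaussRMS_abs_inner (z : EuclideanSpace ℝ ι) :
    gaussRMS (fun x => |inner ℝ z x|) = ‖z‖ := by
  have h1 := variance_dual_stdGaussian (innerSL ℝ z)
  have h2 := integral_strongDual_stdGaussian (innerSL ℝ z)
  rw [variance_eq_integral (innerSL ℝ z).continuous.aemeasurable, h2] at h1
  have h3 : ∀ x : EuclideanSpace ℝ ι, (innerSL ℝ z) x = inner ℝ z x := fun x => rfl
  simp_rw [gaussRMS, sq_abs]
  simp only [sub_zero, h3, innerSL_apply_norm] at h1
  rw [h1, Real.sqrt_sq (norm_nonneg z)]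

/-- In coordinates det(1 + tA) = 1 + t tr A + t² P(t) with P a polynomial. This is how the trace
enters the first-order condition of the Lewis position. -/
theorem hasDerivAt_det_one_add_smul (A : EuclideanSpace ℝ ι →ₗ[ℝ] EuclideanSpace ℝ ι) :
    HasDerivAt (fun t : ℝ => LinearMap.det (1 + t • A))
      (LinearMap.trace ℝ _ A) 0 := by
  classical
  let B := (EuclideanSpace.basisFun ι ℝ).toBasis
  let M := LinearMap.toMatrix B B A
  let P := (Matrix.det (1 + (Polynomial.X : Polynomial ℝ) • M.map Polynomial.C)).divX.divX
  have h : (fun t : ℝ => LinearMap.det (1 + t • A)) =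
      fun t => 1 + Matrix.trace M * t + P.eval t * t ^ 2 := by
    ext t
    rw [← LinearMap.det_toMatrix B, map_add, map_smul, LinearMap.toMatrix_one,
      Matrix.det_one_add_smul]
  rw [h, LinearMap.trace_eq_matrix_trace ℝ B A]
  have h1 := (((hasDerivAt_id (0 : ℝ)).const_mul (Matrix.trace M)).const_add 1).add
    ((P.hasDerivAt 0).mul (hasDerivAt_pow 2 (0 : ℝ)))
  convert! h1 using 1
  simp [M]

theorem nonneg_of_hasDerivAt_of_le {F : ℝ → ℝ} {F' : ℝ} (h : HasDerivAt F F' 0)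
    (hF : ∀ t, 0 ≤ t → F 0 ≤ F t) : 0 ≤ F' := by
  have h1 := h.tendsto_slope_zero_right
  refine ge_of_tendsto h1 ?_
  filter_upwards [self_mem_nhdsWithin] with t ht
  have ht : 0 < t := ht
  have := hF t ht.le
  rw [zero_add, smul_eq_mul]
  exact mul_nonneg (inv_nonneg.2 ht.le) (sub_nonneg.2 this)

section

variable (p : Seminorm ℝ (EuclideanSpace ℝ ι)) {a b : ℝ}

theorem continuous_of_le_norm (hb : ∀ x, p x ≤ b * ‖x‖) : Continuous p := by
  refine (LipschitzWith.of_le_add_mul b.toNNReal fun x y => ?_).continuous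
  have h1 : p x ≤ p y + p (x - y) := by
    have := map_add_le_add p y (x - y)
    rwa [add_sub_cancel] at this
  rw [dist_eq_norm]
  refine h1.trans (add_le_add_right ((hb _).trans ?_) _)
  exact mul_le_mul_of_nonneg_right (Real.le_coe_toNNReal b) (norm_nonneg _)

theorem memLp_comp (hb0 : 0 ≤ b) (hb : ∀ x, p x ≤ b * ‖x‖)
    (u : EuclideanSpace ℝ ι →L[ℝ] EuclideanSpace ℝ ι) :
    MemLp (fun x => p (u x)) 2 (stdGaussian (EuclideanSpace ℝ ι)) := by
  refine memLp_of_le_norm (C := b * ‖u‖) ((continuous_of_le_norm p hb).comp u.continuous)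
    (fun x => apply_nonneg p _) fun x => (hb _).trans ?_
  rw [mul_assoc]
  exact mul_le_mul_of_nonneg_left (u.le_opNorm x) hb0

theorem gaussRMS_comp_add_le (hb0 : 0 ≤ b) (hb : ∀ x, p x ≤ b * ‖x‖)
    (u v : EuclideanSpace ℝ ι →L[ℝ] EuclideanSpace ℝ ι) :
    gaussRMS (fun x => p ((u + v) x)) ≤
      gaussRMS (fun x => p (u x)) + gaussRMS (fun x => p (v x)) :=
  gaussRMS_le_add (memLp_comp p hb0 hb _) (memLp_comp p hb0 hb _) (memLp_comp p hb0 hb _)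
    (fun _ => apply_nonneg p _) (fun _ => apply_nonneg p _) (fun _ => apply_nonneg p _)
    fun x => map_add_le_add p (u x) (v x)

theorem gaussRMS_comp_smul (t : ℝ) (u : EuclideanSpace ℝ ι →L[ℝ] EuclideanSpace ℝ ι) :
    gaussRMS (fun x => p ((t • u) x)) = |t| * gaussRMS (fun x => p (u x)) := by
  simp_rw [gaussRMS, smul_apply, map_smul_eq_mul, mul_pow]
  rw [integral_const_mul, Real.sqrt_mul (sq_nonneg _), Real.sqrt_sq (norm_nonneg t),
    Real.norm_eq_abs]

theorem gaussRMS_comp_le (hb0 : 0 ≤ b) (hb : ∀ x, p x ≤ b * ‖x‖)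
    (u : EuclideanSpace ℝ ι →L[ℝ] EuclideanSpace ℝ ι) :
    gaussRMS (fun x => p (u x)) ≤ b * ‖u‖ * √(Fintype.card ι) := by
  rw [← gaussRMS_norm_mul (ι := ι) (mul_nonneg hb0 (norm_nonneg u))]
  refine gaussRMS_mono (memLp_comp p hb0 hb _) (memLp_norm_stdGaussian.const_mul _)
    (fun _ => apply_nonneg p _) fun x => (hb _).trans ?_
  rw [mul_assoc]
  exact mul_le_mul_of_nonneg_left (u.le_opNorm x) hb0

theorem continuous_gaussRMS_comp (hb0 : 0 ≤ b) (hb : ∀ x, p x ≤ b * ‖x‖) :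
    Continuous fun u : EuclideanSpace ℝ ι →L[ℝ] EuclideanSpace ℝ ι =>
      gaussRMS fun x => p (u x) := by
  have hC : 0 ≤ b * √(Fintype.card ι) := by positivity
  refine (LipschitzWith.of_le_add_mul (b * √(Fintype.card ι)).toNNReal fun u v => ?_).continuous
  rw [Real.coe_toNNReal _ hC, dist_eq_norm]
  have h1 := gaussRMS_comp_add_le p hb0 hb v (u - v)
  rw [add_sub_cancel] at h1
  have h2 := gaussRMS_comp_le p hb0 hb (u - v)
  linarith

/-- Coercivity, which makes the minimum in the Lewis problem exist. Let u* be the adjoint: ‖u* z‖ is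
the quadratic mean of ⟨z, ux⟩, and |⟨z, ux⟩| ≤ ‖z‖ p(ux)/a. -/
theorem mul_norm_le_gaussRMS_comp (ha : 0 < a) (hb0 : 0 ≤ b) (hpa : ∀ x, a * ‖x‖ ≤ p x)
    (hb : ∀ x, p x ≤ b * ‖x‖) (u : EuclideanSpace ℝ ι →L[ℝ] EuclideanSpace ℝ ι) :
    a * ‖u‖ ≤ gaussRMS fun x => p (u x) := by
  rw [← le_div_iff₀' ha, ← ContinuousLinearMap.adjoint.norm_map u]
  refine ContinuousLinearMap.opNorm_le_bound _ (div_nonneg (gaussRMS_nonneg _) ha.le) fun z => ?_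
  rw [div_mul_eq_mul_div, le_div_iff₀' ha, ← gaussRMS_abs_inner]
  rcases eq_or_ne z 0 with rfl | hz
  · simp [gaussRMS]
  have hz' : 0 < ‖z‖ := norm_pos_iff.2 hz
  have key : ∀ x, |inner ℝ (ContinuousLinearMap.adjoint u z) x| ≤ ‖z‖ / a * p (u x) := by
    intro x
    rw [ContinuousLinearMap.adjoint_inner_left, div_mul_eq_mul_div, le_div_iff₀ ha]
    calc |inner ℝ z (u x)| * a ≤ (‖z‖ * ‖u x‖) * a :=
          mul_le_mul_of_nonneg_right (abs_real_inner_le_norm _ _) ha.le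
      _ = ‖z‖ * (a * ‖u x‖) := by ring
      _ ≤ ‖z‖ * p (u x) := mul_le_mul_of_nonneg_left (hpa _) hz'.le
  have hmem : MemLp (fun x => |inner ℝ (ContinuousLinearMap.adjoint u z) x|) 2
      (stdGaussian (EuclideanSpace ℝ ι)) :=
    memLp_of_le_norm (C := ‖ContinuousLinearMap.adjoint u z‖) (by fun_prop)
      (fun _ => abs_nonneg _) fun x => abs_real_inner_le_norm _ _
  have h1 := gaussRMS_mono hmem ((memLp_comp p hb0 hb u).const_mul (‖z‖ / a))
    (fun _ => abs_nonneg _) key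
  have h2 : gaussRMS (fun x => ‖z‖ / a * p (u x)) = ‖z‖ / a * gaussRMS fun x => p (u x) := by
    simp_rw [gaussRMS, mul_pow]
    rw [integral_const_mul, Real.sqrt_mul (sq_nonneg _), Real.sqrt_sq (by positivity)]
  rw [h2, div_mul_eq_mul_div, le_div_iff₀ ha] at h1
  linarith

/-- Every norm has a Gaussian Lewis position: there is a unimodular `u` such that the trace pairing
with `u⁻¹` is dominated by the Gaussian norm. -/
theorem exists_lewis_position [Nonempty ι] (ha : 0 < a) (hb0 : 0 ≤ b)
    (hpa : ∀ x, a * ‖x‖ ≤ p x) (hb : ∀ x, p x ≤ b * ‖x‖) :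
    ∃ u w : EuclideanSpace ℝ ι →L[ℝ] EuclideanSpace ℝ ι,
      u.det = 1 ∧ (∀ x, w (u x) = x) ∧ (∀ x, u (w x) = x) ∧
      0 < gaussRMS (fun x => p (u x)) ∧
      ∀ v : EuclideanSpace ℝ ι →L[ℝ] EuclideanSpace ℝ ι,
        gaussRMS (fun x => p (u x)) *
          LinearMap.trace ℝ _ ((w.comp v : EuclideanSpace ℝ ι →L[ℝ] EuclideanSpace ℝ ι) :
            EuclideanSpace ℝ ι →ₗ[ℝ] EuclideanSpace ℝ ι) ≤
        Fintype.card ι * gaussRMS (fun x => p (v x)) := by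
  let L := EuclideanSpace ℝ ι →L[ℝ] EuclideanSpace ℝ ι
  let ℓ : L → ℝ := fun u => gaussRMS fun x => p (u x)
  have hcont : Continuous ℓ := continuous_gaussRMS_comp p hb0 hb
  have hcoer : ∀ u, a * ‖u‖ ≤ ℓ u := mul_norm_le_gaussRMS_comp p ha hb0 hpa hb
  have hclosed : IsClosed {u : L | u.det = 1} :=
    isClosed_eq ContinuousLinearMap.continuous_det continuous_const
  have hdet1 : (ContinuousLinearMap.id ℝ (EuclideanSpace ℝ ι)).det = 1 := by
    simp [ContinuousLinearMap.det]
  obtain ⟨u, hu, hmin⟩ := hcont.continuousOn.exists_isMinOn' hclosed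
    (x₀ := ContinuousLinearMap.id ℝ _) hdet1 (by
      refine Filter.Eventually.filter_mono inf_le_left ?_
      have ht : Tendsto (fun u : L => a * ‖u‖) (cocompact L) atTop :=
        (tendsto_norm_cocompact_atTop (E := L)).const_mul_atTop ha
      filter_upwards [ht.eventually_ge_atTop (ℓ (ContinuousLinearMap.id ℝ _))] with v hv
      exact hv.trans (hcoer v))
  have hu : u.det = 1 := hu
  have hu' : LinearMap.det (u : EuclideanSpace ℝ ι →ₗ[ℝ] EuclideanSpace ℝ ι) = 1 := hu
  let e := LinearMap.equivOfDetNeZero (u : EuclideanSpace ℝ ι →ₗ[ℝ] EuclideanSpace ℝ ι)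
    (by rw [hu']; exact one_ne_zero)
  have he : ∀ x, e x = u x := fun x => rfl
  let w : L := LinearMap.toContinuousLinearMap (e.symm : EuclideanSpace ℝ ι →ₗ[ℝ] _)
  have hwu : ∀ x, w (u x) = x := fun x => by
    change e.symm (u x) = x
    rw [← he, e.symm_apply_apply]
  have huw : ∀ x, u (w x) = x := fun x => by
    change u (e.symm x) = x
    rw [← he, e.apply_symm_apply]
  have hd : (Fintype.card ι : ℝ) ≠ 0 := by exact_mod_cast Fintype.card_ne_zero
  have hupos : 0 < ℓ u := by
    refine lt_of_lt_of_le (mul_pos ha (norm_pos_iff.2 ?_)) (hcoer u)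
    rintro rfl
    simp [ContinuousLinearMap.det] at hu
  -- Minimality in homogeneous form: rescale v to determinant 1 when det v > 0; otherwise the left
  -- side is nonpositive.
  have hhom : ∀ v : L, v.det * ℓ u ^ Fintype.card ι ≤ ℓ v ^ Fintype.card ι := by
    intro v
    rcases le_or_gt v.det 0 with h | h
    · exact (mul_nonpos_of_nonpos_of_nonneg h (by positivity)).trans
        (pow_nonneg (gaussRMS_nonneg _) _)
    · let s : ℝ := v.det ^ (-(1 / (Fintype.card ι : ℝ)))
      have hs : 0 < s := by positivity
      have hsd : s ^ Fintype.card ι = v.det⁻¹ := by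
        rw [← Real.rpow_natCast, ← Real.rpow_mul h.le, neg_mul, one_div_mul_cancel hd,
          Real.rpow_neg_one]
      have hsv : (s • v).det = 1 := by
        have : (s • v).det = s ^ Fintype.card ι * v.det := by
          have hc : ((s • v : L) : EuclideanSpace ℝ ι →ₗ[ℝ] EuclideanSpace ℝ ι) =
            s • (v : EuclideanSpace ℝ ι →ₗ[ℝ] EuclideanSpace ℝ ι) := rfl
          rw [ContinuousLinearMap.det, hc, LinearMap.det_smul, finrank_euclideanSpace]
        rw [this, hsd, inv_mul_cancel₀ h.ne']
      have h1 : ℓ u ≤ ℓ (s • v) := hmin hsv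
      have h2 : ℓ (s • v) = s * ℓ v := by
        simp only [ℓ]
        rw [gaussRMS_comp_smul, abs_of_pos hs]
      rw [h2] at h1
      have h3 := pow_le_pow_left₀ hupos.le h1 (Fintype.card ι)
      rwa [mul_pow, hsd, le_inv_mul_iff₀ h] at h3
  refine ⟨u, w, hu, hwu, huw, hupos, fun v => ?_⟩
  change ℓ u * _ ≤ _ * ℓ v
  set A : EuclideanSpace ℝ ι →ₗ[ℝ] EuclideanSpace ℝ ι := 
    ((w.comp v : L) : EuclideanSpace ℝ ι →ₗ[ℝ] EuclideanSpace ℝ ι) with hA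
  set d := Fintype.card ι with hdd
  have hdet : ∀ t : ℝ, (u + t • v).det = LinearMap.det (1 + t • A) := by
    intro t
    have : ((u + t • v : L) : EuclideanSpace ℝ ι →ₗ[ℝ] EuclideanSpace ℝ ι) =
        (u : EuclideanSpace ℝ ι →ₗ[ℝ] EuclideanSpace ℝ ι) ∘ₗ (1 + t • A) := by
      ext1 x
      simp [hA, huw]
    rw [ContinuousLinearMap.det, this, LinearMap.det_comp, hu', one_mul]
  have hF : ∀ t : ℝ, 0 ≤ t →
      LinearMap.det (1 + t • A) * ℓ u ^ d ≤ (ℓ u + t * ℓ v) ^ d := by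
    intro t ht
    rw [← hdet]
    refine (hhom _).trans (pow_le_pow_left₀ (gaussRMS_nonneg _) ?_ _)
    have h1 := gaussRMS_comp_add_le p hb0 hb u (t • v)
    rwa [gaussRMS_comp_smul, abs_of_nonneg ht] at h1
  -- This function is nonnegative for t ≥ 0 and vanishes at t = 0, so its derivative there is
  -- nonnegative; that is the trace inequality times ℓ(u)^(d-1).
  have hder : HasDerivAt (fun t : ℝ => (ℓ u + t * ℓ v) ^ d - LinearMap.det (1 + t • A) * ℓ u ^ d)
      (d * ℓ u ^ (d - 1) * ℓ v - LinearMap.trace ℝ _ A * ℓ u ^ d) 0 := by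
    have h1 := ((((hasDerivAt_id (0 : ℝ)).mul_const (ℓ v)).const_add (ℓ u)).pow d).sub
      ((hasDerivAt_det_one_add_smul A).mul_const (ℓ u ^ d))
    convert! h1 using 1
    simp
  have hnn := nonneg_of_hasDerivAt_of_le hder fun t ht => by
    have := hF t ht
    simp
    linarith
  have hd1 : ℓ u ^ d = ℓ u ^ (d - 1) * ℓ u := by
    rw [← pow_succ, Nat.sub_add_cancel Fintype.card_pos]
  rw [hd1] at hnn
  have h5 : 0 ≤ ℓ u ^ (d - 1) * (d * ℓ v - ℓ u * LinearMap.trace ℝ _ A) := by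
    linarith [hnn]
  have h6 := nonneg_of_mul_nonneg_right h5 (pow_pos hupos _)
  linarith

end

end Lewis

/-! ### Duality of Gaussian norms and the Rademacher constant -/

section Duality

open ProbabilityTheory Filter Topology InnerProductSpace

variable {ι : Type*} [Fintype ι]

/-! ### The gauge as a norm equivalent to the Euclidean one, and norming vectors. -/

namespace SymmetricConvexBody

section

variable {E : Type*} [NormedAddCommGroup E] [NormedSpace ℝ E] (K : SymmetricConvexBody E)

/-- The gauge of a symmetric convex body, as a seminorm. -/
def seminorm : Seminorm ℝ E :=
  Seminorm.of (gauge K.carrier) (fun x y => K.normCore.norm_triangle x y)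
    fun c x => K.normCore.norm_smul c x

theorem exists_norm_le_gauge : ∃ a : ℝ, 0 < a ∧ ∀ x, a * ‖x‖ ≤ K.seminorm x := by
  obtain ⟨r, hr0, hr⟩ := K.bounded'.subset_closedBall_lt 0 0
  refine ⟨r⁻¹, inv_pos.2 hr0, fun x => ?_⟩
  rw [inv_mul_eq_div]
  exact le_gauge_of_subset_closedBall (absorbent_nhds_zero K.mem_nhds_zero) hr0.le hr

theorem exists_gauge_le_norm : ∃ b : ℝ, 0 < b ∧ ∀ x, K.seminorm x ≤ b * ‖x‖ := by
  obtain ⟨r, hr0, hr⟩ := Metric.mem_nhds_iff.1 K.mem_nhds_zero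
  refine ⟨r⁻¹, inv_pos.2 hr0, fun x => ?_⟩
  rw [le_inv_mul_iff₀ hr0]
  exact mul_gauge_le_norm hr

end

variable (K : SymmetricConvexBody (EuclideanSpace ℝ ι))

/-- Finiteness is essential: `toReal` would send ∞ to 0 and make the final bound meaningless. -/
theorem rademacherConst_ne_top : rademacherConst K.Space ≠ ∞ := by
  obtain ⟨a, ha0, ha⟩ := K.exists_norm_le_gauge
  obtain ⟨b, hb0, hb⟩ := K.exists_gauge_le_norm
  let T : K.Space →ₗ[ℝ] EuclideanSpace ℝ ι :=
    (LinearMap.id : EuclideanSpace ℝ ι →ₗ[ℝ] EuclideanSpace ℝ ι)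
  refine rademacherConst_ne_top_of_equiv T (a := b⁻¹) (b := a⁻¹) (inv_pos.2 hb0)
    (fun x => ?_) fun x => ?_
  · rw [inv_mul_le_iff₀ hb0]
    exact hb x
  · rw [le_inv_mul_iff₀ ha0]
    exact ha x

theorem sum_seminorm_sq_signProj_le {κ : Type*} [Fintype κ] [DecidableEq κ]
    (f : (κ → ℤˣ) → EuclideanSpace ℝ ι) :
    ∑ t : κ → ℤˣ, K.seminorm (∑ k, ((t k : ℤ) : ℝ) • signCoeff f k) ^ 2 ≤
      (rademacherConst K.Space).toReal ^ 2 * ∑ t, K.seminorm (f t) ^ 2 :=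
  sum_norm_sq_signProj_le_rademacherConst (X := K.Space) K.rademacherConst_ne_top f

theorem isSymmBounded : IsSymmBounded K.carrier :=
  ⟨K.interior_nonempty'.mono interior_subset, K.bounded', K.neg_mem'⟩

/-- K need not be closed, so the maximum is taken on its closure, where the gauge is still at most
1. -/
theorem exists_supportFun_eq (w : EuclideanSpace ℝ ι →L[ℝ] EuclideanSpace ℝ ι)
    (x : EuclideanSpace ℝ ι) :
    ∃ y, K.seminorm y ≤ 1 ∧ inner ℝ x (w y) = supportFun (w '' K.carrier) x := by
  have hcomp : IsCompact (closure K.carrier) := K.bounded'.isCompact_closure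
  obtain ⟨y, hy, hmax⟩ := hcomp.exists_isMaxOn
    (K.isSymmBounded.nonempty.mono subset_closure)
    (f := fun y => inner ℝ x (w y)) (by fun_prop)
  have hA : IsSymmBounded (w '' K.carrier) :=
    K.isSymmBounded.image (w : EuclideanSpace ℝ ι →ₗ[ℝ] EuclideanSpace ℝ ι)
  refine ⟨y, (gauge_le_one_iff_mem_closure K.convex' K.mem_nhds_zero).2 hy, le_antisymm ?_ ?_⟩
  · have hcl : IsClosed {z : EuclideanSpace ℝ ι | inner ℝ x (w z) ≤
        supportFun (w '' K.carrier) x} :=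
      isClosed_le (by fun_prop) continuous_const
    exact closure_minimal (fun z hz => hA.inner_le ⟨z, hz, rfl⟩ x) hcl hy
  · refine hA.supportFun_le ?_
    rintro _ ⟨z, hz, rfl⟩
    exact hmax (subset_closure hz)

end SymmetricConvexBody

variable [DecidableEq ι]

theorem signSum_comp {ι : Type*} (N : ℕ) (σ : Equiv.Perm (Fin N)) (t : ι × Fin N → ℤˣ) :
    signSum N (fun k => t (k.1, σ k.2)) = signSum N t := by
  ext i
  simp only [signSum]
  rw [Equiv.sum_comp σ fun j => ((t (i, j) : ℤ) : ℝ)]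

/-- Swapping two columns of the sign array leaves the normalized sum unchanged, so within a row all
coefficients agree. -/
theorem signCoeff_signSum (N : ℕ) (F : EuclideanSpace ℝ ι → EuclideanSpace ℝ ι) (i : ι)
    (j k : Fin N) :
    signCoeff (fun t => F (signSum N t)) (i, j) = signCoeff (fun t => F (signSum N t)) (i, k) := by
  unfold signCoeff
  congr 1
  let e : (ι × Fin N → ℤˣ) ≃ (ι × Fin N → ℤˣ) :=
    (Equiv.prodCongr (Equiv.refl ι) (Equiv.swap j k)).arrowCongr (Equiv.refl _)
  have he : ∀ t, e t = fun k' => t (k'.1, Equiv.swap j k k'.2) := by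
    intro t
    ext k'
    rfl
  refine Fintype.sum_equiv e _ _ fun t => ?_
  rw [he]
  dsimp only
  rw [signSum_comp, Equiv.swap_apply_right]

/-- The covariance operator `x ↦ E ⟨G, x⟩ F(G)` for a normalized sum of signs `G`. -/
def signCov (N : ℕ) (F : EuclideanSpace ℝ ι → EuclideanSpace ℝ ι) :
    EuclideanSpace ℝ ι →L[ℝ] EuclideanSpace ℝ ι :=
  (1 / 2 ^ Fintype.card (ι × Fin N) : ℝ) •
    ∑ t : ι × Fin N → ℤˣ, rankOne ℝ (F (signSum N t)) (signSum N t)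

/-- The bridge between K-convexity and linear operators: as the coefficients are constant along
rows, the Rademacher projection of F(G) is a linear function of the sign sum G. -/
theorem signCov_signSum {N : ℕ} (hN : 0 < N) (F : EuclideanSpace ℝ ι → EuclideanSpace ℝ ι)
    (t : ι × Fin N → ℤˣ) :
    signCov N F (signSum N t) =
      ∑ k, ((t k : ℤ) : ℝ) • signCoeff (fun s => F (signSum N s)) k := by
  have hN' : (0 : ℝ) < N := by exact_mod_cast hN
  have hinner : ∀ s : ι × Fin N → ℤˣ, inner ℝ (signSum N s) (signSum N t) =
      (N : ℝ)⁻¹ * ∑ i, ∑ j, ∑ k, ((t (i, j) : ℤ) : ℝ) * ((s (i, k) : ℤ) : ℝ) := by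
    intro s
    rw [PiLp.inner_apply, Finset.mul_sum]
    refine Finset.sum_congr rfl fun i _ => ?_
    rw [← Finset.sum_mul_sum]
    simp only [signSum, RCLike.inner_apply, conj_trivial]
    have : ((√N)⁻¹ : ℝ) * (√N)⁻¹ = (N : ℝ)⁻¹ := by
      rw [← mul_inv, Real.mul_self_sqrt hN'.le]
    rw [← this]
    ring
  have hcoef : ∀ k : ι × Fin N, signCoeff (fun s => F (signSum N s)) k =
      (1 / 2 ^ Fintype.card (ι × Fin N) : ℝ) • ∑ s, ((s k : ℤ) : ℝ) • F (signSum N s) :=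
    fun k => rfl
  have hdiag : ∀ (i : ι) (j : Fin N), signCoeff (fun s => F (signSum N s)) (i, j) =
      (N : ℝ)⁻¹ • ∑ k, signCoeff (fun s => F (signSum N s)) (i, k) := by
    intro i j
    rw [Finset.sum_congr rfl fun k _ => signCoeff_signSum N F i k j]
    simp only [Finset.sum_const, Finset.card_univ, Fintype.card_fin]
    rw [← Nat.cast_smul_eq_nsmul ℝ, smul_smul, inv_mul_cancel₀ hN'.ne', one_smul]
  rw [Fintype.sum_prod_type, Finset.sum_congr rfl fun i _ => Finset.sum_congr rfl fun j _ =>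
    congrArg (((t (i, j) : ℤ) : ℝ) • ·) (hdiag i j)]
  simp_rw [hcoef]
  simp only [signCov, smul_apply, sum_apply, rankOne_apply, hinner]
  simp only [Finset.smul_sum, Finset.mul_sum, Finset.sum_smul, smul_smul]
  rw [Finset.sum_comm]
  refine Finset.sum_congr rfl fun i _ => ?_
  rw [Finset.sum_comm]
  refine Finset.sum_congr rfl fun j _ => ?_
  rw [Finset.sum_comm]
  refine Finset.sum_congr rfl fun k _ => Finset.sum_congr rfl fun s _ => ?_
  congr 1
  ring

/-- The bound is uniform in N, so a subsequence of the covariance operators converges. -/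
theorem norm_signCov_le {N : ℕ} (hN : 0 < N) (F : EuclideanSpace ℝ ι → EuclideanSpace ℝ ι)
    {C : ℝ} (hF : ∀ x, ‖F x‖ ≤ C * ‖x‖) :
    ‖signCov N F‖ ≤ C * Fintype.card ι := by
  rw [← sum_norm_sq_signSum (ι := ι) hN, signCov, norm_smul, Real.norm_of_nonneg (by positivity),
    mul_left_comm]
  refine mul_le_mul_of_nonneg_left ((norm_sum_le _ _).trans ?_) (by positivity)
  rw [Finset.mul_sum]
  refine Finset.sum_le_sum fun t _ => ?_
  rw [norm_rankOne, sq, ← mul_assoc]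
  exact mul_le_mul_of_nonneg_right (hF _) (norm_nonneg _)

theorem trace_comp_signCov (N : ℕ) (F : EuclideanSpace ℝ ι → EuclideanSpace ℝ ι)
    (w : EuclideanSpace ℝ ι →L[ℝ] EuclideanSpace ℝ ι) :
    LinearMap.trace ℝ _ ((w.comp (signCov N F) : EuclideanSpace ℝ ι →L[ℝ] EuclideanSpace ℝ ι) :
      EuclideanSpace ℝ ι →ₗ[ℝ] EuclideanSpace ℝ ι) =
      (1 / 2 ^ Fintype.card (ι × Fin N) : ℝ) *
        ∑ t : ι × Fin N → ℤˣ, inner ℝ (signSum N t) (w (F (signSum N t))) := by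
  have h : ((w.comp (signCov N F) : EuclideanSpace ℝ ι →L[ℝ] EuclideanSpace ℝ ι) :
      EuclideanSpace ℝ ι →ₗ[ℝ] EuclideanSpace ℝ ι) =
      (1 / 2 ^ Fintype.card (ι × Fin N) : ℝ) • ∑ t : ι × Fin N → ℤˣ,
        ((rankOne ℝ (w (F (signSum N t))) (signSum N t) :
          EuclideanSpace ℝ ι →L[ℝ] EuclideanSpace ℝ ι) :
            EuclideanSpace ℝ ι →ₗ[ℝ] EuclideanSpace ℝ ι) := by
    ext1 x
    simp [signCov, rankOne_apply]
  rw [h, map_smul, map_sum, smul_eq_mul]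
  simp_rw [trace_rankOne]

/-- The average of `f (G)` for a normalized sum of signs `G`. -/
def signAvg (N : ℕ) (f : EuclideanSpace ℝ ι → ℝ) : ℝ :=
  (1 / 2 ^ Fintype.card (ι × Fin N) : ℝ) * ∑ t : ι × Fin N → ℤˣ, f (signSum N t)

theorem signAvg_mono (N : ℕ) {f g : EuclideanSpace ℝ ι → ℝ} (h : ∀ x, f x ≤ g x) :
    signAvg N f ≤ signAvg N g :=
  mul_le_mul_of_nonneg_left (Finset.sum_le_sum fun _ _ => h _) (by positivity)

theorem signAvg_linear (N : ℕ) (f g : EuclideanSpace ℝ ι → ℝ) (c c' : ℝ) :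
    signAvg N (fun x => c * f x + c' * g x) = c * signAvg N f + c' * signAvg N g := by
  simp only [signAvg, Finset.sum_add_distrib, ← Finset.mul_sum]
  ring

/-- The Gaussian `K`-convexity estimate: if `v` is a limit of covariance operators of norming
functions, then its Gaussian norm is controlled by the Rademacher constant. -/
theorem exists_gaussian_dual (K : SymmetricConvexBody (EuclideanSpace ℝ ι))
    (w : EuclideanSpace ℝ ι →L[ℝ] EuclideanSpace ℝ ι) :
    ∃ v : EuclideanSpace ℝ ι →L[ℝ] EuclideanSpace ℝ ι,
      gaussRMS (supportFun (w '' K.carrier)) ^ 2 ≤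
        LinearMap.trace ℝ _ ((w.comp v : EuclideanSpace ℝ ι →L[ℝ] EuclideanSpace ℝ ι) :
          EuclideanSpace ℝ ι →ₗ[ℝ] EuclideanSpace ℝ ι) ∧
      gaussRMS (fun x => K.seminorm (v x)) ^ 2 ≤ (rademacherConst K.Space).toReal ^ 2 *
        LinearMap.trace ℝ _ ((w.comp v : EuclideanSpace ℝ ι →L[ℝ] EuclideanSpace ℝ ι) :
          EuclideanSpace ℝ ι →ₗ[ℝ] EuclideanSpace ℝ ι) := by
  obtain ⟨a, ha0, ha⟩ := K.exists_norm_le_gauge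
  obtain ⟨b, hb0, hb⟩ := K.exists_gauge_le_norm
  set R := (rademacherConst K.Space).toReal with hR
  set h := supportFun (w '' K.carrier) with hh
  have hA : IsSymmBounded (w '' K.carrier) :=
    K.isSymmBounded.image (w : EuclideanSpace ℝ ι →ₗ[ℝ] EuclideanSpace ℝ ι)
  obtain ⟨C, hC0, hC⟩ := hA.exists_supportFun_le_mul_norm
  choose y hy1 hy2 using K.exists_supportFun_eq w
  -- Chosen so that ⟨x, w F(x)⟩ = h(x)² and ‖F(x)‖_K ≤ h(x). The selection y need not be measurable,
  -- since F is only averaged over finite sets of signs.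
  let F : EuclideanSpace ℝ ι → EuclideanSpace ℝ ι := fun x => h x • y x
  have hh0 : ∀ x, 0 ≤ h x := hA.supportFun_nonneg
  have hF : ∀ x, ‖F x‖ ≤ (C * a⁻¹) * ‖x‖ := by
    intro x
    have h1 : ‖y x‖ ≤ a⁻¹ := by
      rw [← one_div, le_div_iff₀' ha0]
      exact (ha _).trans (hy1 x)
    rw [norm_smul, Real.norm_of_nonneg (hh0 x), mul_right_comm]
    exact mul_le_mul (hC x) h1 (norm_nonneg _) (mul_nonneg hC0 (norm_nonneg _))
  let τ : (EuclideanSpace ℝ ι →L[ℝ] EuclideanSpace ℝ ι) → ℝ := fun v =>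
    LinearMap.trace ℝ _ ((w.comp v : EuclideanSpace ℝ ι →L[ℝ] EuclideanSpace ℝ ι) :
      EuclideanSpace ℝ ι →ₗ[ℝ] EuclideanSpace ℝ ι)
  have hτ : Continuous τ := by
    let τ' : (EuclideanSpace ℝ ι →L[ℝ] EuclideanSpace ℝ ι) →ₗ[ℝ] ℝ :=
      { toFun := τ
        map_add' := fun v v' => by
          simp only [τ, ContinuousLinearMap.comp_add, ContinuousLinearMap.toLinearMap_add, map_add]
        map_smul' := fun c v => by
          simp only [τ, ContinuousLinearMap.comp_smul, ContinuousLinearMap.toLinearMap_smul,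
            map_smul, RingHom.id_apply] }
    exact τ'.continuous_of_finiteDimensional
  have htr : ∀ N, τ (signCov N F) = signAvg N fun x => h x ^ 2 := by
    intro N
    simp only [τ]
    rw [trace_comp_signCov, signAvg]
    congr 1
    refine Finset.sum_congr rfl fun t _ => ?_
    simp only [F, map_smul, inner_smul_right]
    rw [hy2, sq]
  have hrad : ∀ N, 0 < N → signAvg N (fun x => K.seminorm (signCov N F x) ^ 2) ≤
      R ^ 2 * τ (signCov N F) := by
    intro N hN
    rw [htr, signAvg, signAvg]
    have h1 := K.sum_seminorm_sq_signProj_le fun t : ι × Fin N → ℤˣ => F (signSum N t)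
    have h2 : ∑ t : ι × Fin N → ℤˣ, K.seminorm (F (signSum N t)) ^ 2 ≤
        ∑ t : ι × Fin N → ℤˣ, h (signSum N t) ^ 2 := by
      refine Finset.sum_le_sum fun t _ => pow_le_pow_left₀ (apply_nonneg _ _) ?_ 2
      simp only [F]
      rw [map_smul_eq_mul, Real.norm_of_nonneg (hh0 _)]
      exact mul_le_of_le_one_right (hh0 _) (hy1 _)
    simp_rw [signCov_signSum hN]
    rw [mul_left_comm]
    refine mul_le_mul_of_nonneg_left (h1.trans ?_) (by positivity)
    exact mul_le_mul_of_nonneg_left h2 (sq_nonneg _)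
  -- The shift to N + 1 avoids the empty sum of signs at N = 0.
  obtain ⟨v, -, φ, hφ, hlim⟩ := (isCompact_closedBall
    (0 : EuclideanSpace ℝ ι →L[ℝ] EuclideanSpace ℝ ι)
    (C * a⁻¹ * Fintype.card ι)).tendsto_subseq (x := fun N => signCov (N + 1) F) fun N => by
      rw [mem_closedBall_zero_iff]
      exact norm_signCov_le N.succ_pos F hF
  have hφ' : StrictMono fun N => φ N + 1 := fun _ _ hab => Nat.succ_lt_succ (hφ hab)
  have hτlim : Tendsto (fun N => τ (signCov (φ N + 1) F)) atTop (𝓝 (τ v)) :=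
    (hτ.tendsto v).comp hlim
  have hpcont := continuous_of_le_norm K.seminorm hb
  refine ⟨v, ?_, ?_⟩
  · rw [gaussRMS_sq]
    refine integral_stdGaussian_le_of_tendsto (hA.continuous_supportFun.pow 2)
      (fun x => sq_nonneg _) hφ' hτlim fun N => ?_
    rw [htr]
    exact le_rfl
  -- The operator varies with N along with the law, so v is compared with the N-th operator through
  -- (α+β)² ≤ (1+δ)α² + (1+1/δ)β². The β-term vanishes as N → ∞, and then δ → 0.
  · have key : ∀ δ : ℝ, 0 < δ → gaussRMS (fun x => K.seminorm (v x)) ^ 2 ≤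
        (1 + δ) * (R ^ 2 * τ v) := by
      intro δ hδ
      rw [gaussRMS_sq]
      have hnorm : Tendsto (fun N => ‖v - signCov (φ N + 1) F‖) atTop (𝓝 0) := by
        have := (tendsto_const_nhds (x := v)).sub hlim
        rw [sub_self] at this
        simpa using this.norm
      have hb' : Tendsto (fun N => (1 + δ) * (R ^ 2 * τ (signCov (φ N + 1) F)) +
          (1 + δ⁻¹) * ((b * ‖v - signCov (φ N + 1) F‖) ^ 2 * Fintype.card ι)) atTop
          (𝓝 ((1 + δ) * (R ^ 2 * τ v))) := by
        have h1 := ((hτlim.const_mul (R ^ 2)).const_mul (1 + δ)).add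
          (((((hnorm.const_mul b).pow 2).mul_const (Fintype.card ι : ℝ))).const_mul (1 + δ⁻¹))
        simpa using h1
      refine integral_stdGaussian_le_of_tendsto ((hpcont.comp v.continuous).pow 2)
        (fun x => sq_nonneg _) hφ' hb' fun N => ?_
      set M := φ N + 1
      set vN := signCov M F with hvN
      have hpt : ∀ x, K.seminorm (v x) ^ 2 ≤ (1 + δ) * K.seminorm (vN x) ^ 2 +
          (1 + δ⁻¹) * (b * ‖v - vN‖) ^ 2 * ‖x‖ ^ 2 := by
        intro x
        have h1 : K.seminorm (v x) ≤ K.seminorm (vN x) + b * ‖v - vN‖ * ‖x‖ := by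
          have h2 := map_add_le_add K.seminorm (vN x) ((v - vN) x)
          have h3 : vN x + (v - vN) x = v x := by simp
          rw [h3] at h2
          refine h2.trans (add_le_add_right ((hb _).trans ?_) _)
          rw [mul_assoc]
          exact mul_le_mul_of_nonneg_left ((v - vN).le_opNorm x) hb0.le
        set α := K.seminorm (vN x)
        set β := b * ‖v - vN‖ * ‖x‖ with hβ
        have h4 : K.seminorm (v x) ^ 2 ≤ (α + β) ^ 2 :=
          pow_le_pow_left₀ (apply_nonneg _ _) h1 2
        have h5 : 0 ≤ δ⁻¹ * (δ * α - β) ^ 2 := by positivity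
        have h6 : δ⁻¹ * (δ * α - β) ^ 2 = δ * α ^ 2 - 2 * α * β + δ⁻¹ * β ^ 2 := by
          field_simp
          ring
        have h7 : (1 + δ⁻¹) * (b * ‖v - vN‖) ^ 2 * ‖x‖ ^ 2 = (1 + δ⁻¹) * β ^ 2 := by
          rw [hβ]; ring
        rw [h7]
        nlinarith
      have h8 := signAvg_mono M hpt
      rw [signAvg_linear] at h8
      have h9 : signAvg M (fun x : EuclideanSpace ℝ ι => ‖x‖ ^ 2) = Fintype.card ι :=
        sum_norm_sq_signSum (Nat.succ_pos _)
      rw [h9] at h8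
      have h10 := hrad M (Nat.succ_pos _)
      calc _ ≤ _ := h8
        _ ≤ (1 + δ) * (R ^ 2 * τ vN) + (1 + δ⁻¹) * (b * ‖v - vN‖) ^ 2 * Fintype.card ι := by
          gcongr
        _ = _ := by ring
    have hlim2 : Tendsto (fun δ : ℝ => (1 + δ) * (R ^ 2 * τ v)) (𝓝[>] 0)
        (𝓝 ((1 + 0) * (R ^ 2 * τ v))) := by
      refine Tendsto.mono_left (Continuous.tendsto ?_ 0) nhdsWithin_le_nhds
      fun_prop
    have := ge_of_tendsto hlim2 (by
      filter_upwards [self_mem_nhdsWithin] with δ hδ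
      exact key δ hδ)
    rwa [add_zero, one_mul] at this

/-- In Lewis position the dual Gaussian norm is controlled by the Rademacher constant. -/
theorem gaussRMS_mul_gaussRMS_dual_le (K : SymmetricConvexBody (EuclideanSpace ℝ ι))
    (w : EuclideanSpace ℝ ι →L[ℝ] EuclideanSpace ℝ ι) {L : ℝ} (hL : 0 < L)
    (hw : ∀ v : EuclideanSpace ℝ ι →L[ℝ] EuclideanSpace ℝ ι,
        L * LinearMap.trace ℝ _ ((w.comp v : EuclideanSpace ℝ ι →L[ℝ] EuclideanSpace ℝ ι) :
            EuclideanSpace ℝ ι →ₗ[ℝ] EuclideanSpace ℝ ι) ≤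
        Fintype.card ι * gaussRMS (fun x => K.seminorm (v x))) :
    L * gaussRMS (supportFun (w '' K.carrier)) ≤
      Fintype.card ι * (rademacherConst K.Space).toReal := by
  obtain ⟨v, h1, h2⟩ := exists_gaussian_dual K w
  have h3 := hw v
  set τ := LinearMap.trace ℝ _ ((w.comp v : EuclideanSpace ℝ ι →L[ℝ] EuclideanSpace ℝ ι) :
            EuclideanSpace ℝ ι →ₗ[ℝ] EuclideanSpace ℝ ι)
  set R := (rademacherConst K.Space).toReal
  set H := gaussRMS (supportFun (w '' K.carrier))
  have hH : 0 ≤ H := gaussRMS_nonneg _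
  have hR : 0 ≤ R := ENNReal.toReal_nonneg
  have hτ0 : 0 ≤ τ := (sq_nonneg _).trans h1
  -- With ℓ(v) ≤ R√τ and H ≤ √τ, the hypothesis gives Lτ ≤ dR√τ; dividing by √τ needs τ ≠ 0.
  rcases hτ0.eq_or_lt with h | h
  · have : H = 0 := by
      rw [← h] at h1
      exact pow_eq_zero_iff two_ne_zero |>.1 (le_antisymm h1 (sq_nonneg _))
    rw [this, mul_zero]
    positivity
  · have hs : 0 < √τ := Real.sqrt_pos.2 h
    have h4 : gaussRMS (fun x => K.seminorm (v x)) ≤ R * √τ := by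
      refine (pow_le_pow_iff_left₀ (gaussRMS_nonneg _) (by positivity) two_ne_zero).1 ?_
      rwa [mul_pow, Real.sq_sqrt hτ0]
    have h5 : H ≤ √τ := Real.le_sqrt_of_sq_le h1
    have h6 : L * √τ * √τ ≤ Fintype.card ι * R * √τ := by
      rw [mul_assoc, Real.mul_self_sqrt hτ0, mul_assoc]
      exact h3.trans (mul_le_mul_of_nonneg_left h4 (by positivity))
    exact (mul_le_mul_of_nonneg_left h5 hL.le).trans (le_of_mul_le_mul_right h6 hs)

end Duality

/-! ### Gaussian norms and volume -/

section Volume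

open ProbabilityTheory Filter Topology
open scoped Pointwise

/-- This fixes the constant 5 of the volume bound: 4/25 is 2²/5², and the factor 3/4 is the Gaussian
mass left by Markov's inequality. Stirling's bound with e < 3 leaves room to spare. -/
theorem pow_le_factorial {n : ℕ} (hn : 0 < n) :
    ((4 : ℝ) * n / 25) ^ n ≤ 3 / 4 * (Nat.factorial n : ℝ) := by
  have hn' : (1 : ℝ) ≤ n := by exact_mod_cast hn
  have h1 := Stirling.le_factorial_stirling n
  have h2 : 1 ≤ √(2 * Real.pi * n) := by
    rw [Real.one_le_sqrt]
    nlinarith [Real.pi_gt_three]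
  have h3 : ((n : ℝ) / Real.exp 1) ^ n ≤ Nat.factorial n :=
    (le_mul_of_one_le_left (by positivity) h2).trans h1
  have h4 : ((4 : ℝ) * n / 25) ^ n ≤ (3 / 4) ^ n * ((n : ℝ) / Real.exp 1) ^ n := by
    rw [← mul_pow]
    refine pow_le_pow_left₀ (by positivity) ?_ n
    have he : Real.exp 1 < 3 := Real.exp_one_lt_three
    have h5 : (4 : ℝ) / 25 ≤ 3 / 4 * (1 / Real.exp 1) := by
      rw [mul_one_div, div_le_div_iff₀ (by norm_num) (Real.exp_pos _)]
      linarith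
    calc (4 : ℝ) * n / 25 = 4 / 25 * n := by ring
      _ ≤ 3 / 4 * (1 / Real.exp 1) * n := mul_le_mul_of_nonneg_right h5 (by positivity)
      _ = _ := by ring
  have h6 : ((3 : ℝ) / 4) ^ n ≤ 3 / 4 := pow_le_of_le_one (by norm_num) (by norm_num) hn.ne'
  exact h4.trans (mul_le_mul h6 h3 (by positivity) (by norm_num))

variable {ι : Type*} [Fintype ι]

/-- Markov's inequality for the Gaussian norm. -/
theorem three_fourths_le_stdGaussian {f : EuclideanSpace ℝ ι → ℝ} (hf : Continuous f)
    (hf0 : ∀ x, 0 ≤ f x) (hfm : MemLp f 2 (stdGaussian (EuclideanSpace ℝ ι)))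
    (hpos : 0 < gaussRMS f) :
    3 / 4 ≤ (stdGaussian (EuclideanSpace ℝ ι)).real {x | f x < 2 * gaussRMS f} := by
  have h1 := mul_meas_ge_le_integral_of_nonneg (μ := stdGaussian (EuclideanSpace ℝ ι))
    (ae_of_all _ fun x => sq_nonneg (f x)) hfm.integrable_sq ((2 * gaussRMS f) ^ 2)
  rw [← gaussRMS_sq] at h1
  have h2 : {x | f x < 2 * gaussRMS f}ᶜ = {x | (2 * gaussRMS f) ^ 2 ≤ f x ^ 2} := by
    ext x
    simp only [Set.mem_compl_iff, Set.mem_ofPred_eq, not_lt]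
    exact (pow_le_pow_iff_left₀ (by positivity) (hf0 x) two_ne_zero).symm
  have hms : MeasurableSet {x | f x < 2 * gaussRMS f} :=
    (isOpen_lt hf continuous_const).measurableSet
  have h3 := probReal_add_probReal_compl (μ := stdGaussian (EuclideanSpace ℝ ι)) hms
  rw [h2] at h3
  have h4 : 0 < gaussRMS f ^ 2 := by positivity
  have h5 : (stdGaussian (EuclideanSpace ℝ ι)).real {x | (2 * gaussRMS f) ^ 2 ≤ f x ^ 2} ≤ 1 / 4 := by
    have h6 : (2 * gaussRMS f) ^ 2 *
        (stdGaussian (EuclideanSpace ℝ ι)).real {x | (2 * gaussRMS f) ^ 2 ≤ f x ^ 2} ≤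
        gaussRMS f ^ 2 := h1
    generalize (stdGaussian (EuclideanSpace ℝ ι)).real {x | (2 * gaussRMS f) ^ 2 ≤ f x ^ 2} = m
      at h6
    nlinarith
  linarith

/-- The strict sublevel set of the gauge lies in cK even when K is not closed, and u preserves
volume. -/
theorem SymmetricConvexBody.volume_le (K : SymmetricConvexBody (EuclideanSpace ℝ ι))
    (u : EuclideanSpace ℝ ι →L[ℝ] EuclideanSpace ℝ ι) (hu : u.det = 1) {c : ℝ} (hc : 0 < c) :
    volume {x | K.seminorm (u x) < c} ≤
      ENNReal.ofReal (c ^ Fintype.card ι) * volume K.carrier := by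
  have hsub : {x | K.seminorm x < c} ⊆ c • K.carrier := by
    intro x hx
    rw [Set.mem_smul_set_iff_inv_smul_mem₀ hc.ne']
    refine setOfPred_gauge_lt_one_subset_self K.convex' (mem_of_mem_nhds K.mem_nhds_zero)
      (absorbent_nhds_zero K.mem_nhds_zero) ?_
    have hx' : K.seminorm x < c := hx
    change K.seminorm (c⁻¹ • x) < 1
    rw [map_smul_eq_mul, Real.norm_of_nonneg (inv_nonneg.2 hc.le), inv_mul_lt_iff₀ hc, mul_one]
    exact hx'
  have h1 : {x | K.seminorm (u x) < c} = u ⁻¹' {x | K.seminorm x < c} := rfl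
  have hu' : LinearMap.det (u : EuclideanSpace ℝ ι →ₗ[ℝ] EuclideanSpace ℝ ι) = 1 := hu
  rw [h1, Measure.addHaar_preimage_continuousLinearMap _ (by rw [hu']; exact one_ne_zero), hu']
  have h2 := Measure.addHaar_smul volume c K.carrier
  rw [finrank_euclideanSpace, abs_of_pos (pow_pos hc _)] at h2
  rw [← h2]
  rw [inv_one, abs_one, ENNReal.ofReal_one, one_mul]
  exact measure_mono hsub

/-- The Gaussian norm of a unimodular image is bounded below by the volume radius. -/
theorem SymmetricConvexBody.sqrt_le_gaussRMS_mul_volume {n : ℕ} (hn : 0 < n)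
    (K : SymmetricConvexBody (PhaseSpace n))
    (u : PhaseSpace n →L[ℝ] PhaseSpace n) (hu : u.det = 1)
    (hpos : 0 < gaussRMS fun x => K.seminorm (u x)) :
    √(2 * n) ≤ 5 * gaussRMS (fun x => K.seminorm (u x)) *
      (volume.real K.carrier / volume.real (Metric.ball (0 : PhaseSpace n) 1)) ^
        (1 / (2 * (n : ℝ))) := by
  obtain ⟨b, hb0, hb⟩ := K.exists_gauge_le_norm
  set ℓ := gaussRMS fun x => K.seminorm (u x) with hℓ
  have : Nontrivial (PhaseSpace n) := by
    have : Nonempty (Fin n) := ⟨⟨0, hn⟩⟩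
    infer_instance
  have hn' : (0 : ℝ) < n := by exact_mod_cast hn
  have hcard : Fintype.card (Fin n ⊕ Fin n) = 2 * n := by simp [two_mul]
  have hcont : Continuous fun x => K.seminorm (u x) :=
    (continuous_of_le_norm K.seminorm hb).comp u.continuous
  have h1 := three_fourths_le_stdGaussian hcont (fun _ => apply_nonneg _ _)
    (memLp_comp K.seminorm hb0.le hb u) hpos
  have hms : MeasurableSet {x | K.seminorm (u x) < 2 * ℓ} :=
    (isOpen_lt hcont continuous_const).measurableSet
  have h2 := (stdGaussian_le_volume _ hms).trans
    (mul_le_mul_right (K.volume_le u hu (c := 2 * ℓ) (by positivity)) _)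
  have hKfin : volume K.carrier ≠ ∞ := K.bounded'.measure_lt_top.ne
  have h3 : (stdGaussian (PhaseSpace n)).real {x | K.seminorm (u x) < 2 * ℓ} ≤
      ((2 * Real.pi) ^ n)⁻¹ * ((2 * ℓ) ^ (2 * n) * volume.real K.carrier) := by
    have h4 := ENNReal.toReal_mono (by finiteness) h2
    rw [ENNReal.toReal_mul, ENNReal.toReal_mul, ENNReal.toReal_ofReal (by positivity),
      ENNReal.toReal_ofReal (by positivity), hcard] at h4
    have h5 : (2 * Real.pi) ^ (((2 * n : ℕ) : ℝ) / 2) = (2 * Real.pi) ^ n := by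
      rw [← Real.rpow_natCast]
      congr 1
      push_cast
      ring
    rw [h5] at h4
    exact h4
  have hball : volume.real (Metric.ball (0 : PhaseSpace n) 1) = Real.pi ^ n / Nat.factorial n := by
    rw [Measure.real, InnerProductSpace.volume_ball_of_dim_even (k := n) (by simp [two_mul])]
    simp
    positivity
  set V := volume.real K.carrier with hV
  have hV0 : 0 ≤ V := measureReal_nonneg
  rw [hball]
  have hfac : (0 : ℝ) < Nat.factorial n := by exact_mod_cast Nat.factorial_pos n
  have h6 := h1.trans h3
  rw [le_inv_mul_iff₀ (by positivity), mul_pow, pow_mul, mul_pow] at h6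
  -- So far 3/4 (2π)^n ≤ (2ℓ)^(2n) Vol K. The unit ball has volume π^n/n!, so the powers of π cancel
  -- and `pow_le_factorial` remains.
  have h7 : (√(2 * n) / (5 * ℓ)) ^ (2 * n) ≤ V / (Real.pi ^ n / Nat.factorial n) := by
    rw [pow_mul, div_pow, Real.sq_sqrt (by positivity), div_div_eq_mul_div,
      le_div_iff₀ (by positivity)]
    have h8 := pow_le_factorial hn
    have h9 : (2 * (n : ℝ) / (5 * ℓ) ^ 2) ^ n * (2 ^ 2 * ℓ ^ 2) ^ n = 2 ^ n * (4 * n / 25) ^ n := by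
      have hmp : ∀ x y : ℝ, x ^ n * y ^ n = (x * y) ^ n := fun x y => (mul_pow x y n).symm
      rw [hmp, hmp]
      congr 1
      field_simp
      norm_num
    have hQ : 0 < (2 ^ 2 * ℓ ^ 2) ^ n := by positivity
    refine le_of_mul_le_mul_right ?_ hQ
    calc (2 * (n : ℝ) / (5 * ℓ) ^ 2) ^ n * Real.pi ^ n * (2 ^ 2 * ℓ ^ 2) ^ n
        = 2 ^ n * Real.pi ^ n * (4 * n / 25) ^ n := by
          rw [mul_right_comm, h9]; ring
      _ ≤ 2 ^ n * Real.pi ^ n * (3 / 4 * Nat.factorial n) :=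
          mul_le_mul_of_nonneg_left h8 (by positivity)
      _ = (2 ^ n * Real.pi ^ n * (3 / 4)) * Nat.factorial n := by ring
      _ ≤ ((2 ^ 2 * ℓ ^ 2) ^ n * V) * Nat.factorial n := by
          refine mul_le_mul_of_nonneg_right ?_ hfac.le
          rw [mul_pow (2 ^ 2 : ℝ)]
          calc _ ≤ _ := h6
            _ = _ := by ring
      _ = _ := by ring
  have h10 : √(2 * n) / (5 * ℓ) ≤ (V / (Real.pi ^ n / Nat.factorial n)) ^ (1 / (2 * (n : ℝ))) := by
    have h11 := Real.pow_rpow_inv_natCast (x := √(2 * n) / (5 * ℓ)) (n := 2 * n)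
      (by positivity) (by omega)
    rw [← h11]
    have h12 : ((2 * n : ℕ) : ℝ)⁻¹ = 1 / (2 * (n : ℝ)) := by push_cast; rw [one_div]
    rw [h12]
    exact Real.rpow_le_rpow (by positivity) h7 (by positivity)
  rw [div_le_iff₀ (by positivity)] at h10
  linarith

end Volume

/-! ### Williamson's theorem -/

section Williamson

/-- The normal form of an injective skew-adjoint operator. -/
theorem exists_skew_normal_form {V : Type*} [NormedAddCommGroup V] [InnerProductSpace ℝ V]
    [FiniteDimensional ℝ V] (n : ℕ) (A : V →ₗ[ℝ] V)
    (hskew : ∀ x y, inner ℝ (A x) y = -inner ℝ x (A y)) (hinj : ∀ x, A x = 0 → x = 0)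
    (hn : Module.finrank ℝ V = 2 * n) :
    ∃ (e f : Fin n → V) (μ : Fin n → ℝ), (∀ i, 0 < μ i) ∧ Orthonormal ℝ (Sum.elim e f) ∧
      (∀ i, A (e i) = μ i • f i) ∧ ∀ i, A (f i) = -μ i • e i := by
  induction n generalizing V with
  | zero =>
    refine ⟨Fin.elim0, Fin.elim0, Fin.elim0, fun i => i.elim0, ⟨?_, ?_⟩, fun i => i.elim0,
      fun i => i.elim0⟩
    · rintro (i | i) <;> exact i.elim0
    · rintro (i | i) <;> exact i.elim0
  | succ n ih =>
    -- A unit eigenvector v of the symmetric operator A² has eigenvalue -‖Av‖², so v and Av span an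
    -- A-invariant plane.
    have hsymm : (A ∘ₗ A).IsSymmetric := by
      intro x y
      simp [hskew]
    let bas := hsymm.eigenvectorBasis hn
    let v : V := bas ⟨0, by omega⟩
    have hv1 : ‖v‖ = 1 := bas.orthonormal.1 _
    obtain ⟨c, hc⟩ : ∃ c : ℝ, A (A v) = c • v :=
      ⟨_, hsymm.apply_eigenvectorBasis hn ⟨0, by omega⟩⟩
    have hAv : A v ≠ 0 := fun h => by
      have := hinj v h
      rw [this, norm_zero] at hv1
      exact zero_ne_one hv1
    set μ := ‖A v‖ with hμ
    have hμ0 : 0 < μ := norm_pos_iff.2 hAv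
    have hc' : c = -μ ^ 2 := by
      have h1 := hskew v (A v)
      rw [real_inner_self_eq_norm_sq, hc, inner_smul_right, real_inner_self_eq_norm_sq, hv1] at h1
      rw [hμ, h1]
      ring
    let f : V := μ⁻¹ • A v
    have hf1 : ‖f‖ = 1 := by
      rw [norm_smul, norm_inv, Real.norm_of_nonneg hμ0.le, inv_mul_cancel₀ hμ0.ne']
    have hAvf : A v = μ • f := by
      rw [smul_smul, mul_inv_cancel₀ hμ0.ne', one_smul]
    have hAf : A f = -μ • v := by
      rw [map_smul, hc, smul_smul, hc']
      congr 1
      field_simp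
    have hvAv : inner ℝ v (A v) = 0 := by
      have := hskew v v
      rw [real_inner_comm] at this
      linarith
    have hvf : inner ℝ v f = 0 := by
      rw [inner_smul_right, hvAv, mul_zero]
    let U := Submodule.span ℝ ({v, f} : Set V)
    have hmem : ∀ x, x ∈ Uᗮ ↔ inner ℝ v x = 0 ∧ inner ℝ f x = 0 := by
      intro x
      rw [Submodule.mem_orthogonal]
      constructor
      · intro h
        exact ⟨h v (Submodule.subset_span (by simp)), h f (Submodule.subset_span (by simp))⟩
      · rintro ⟨h1, h2⟩ y hy
        obtain ⟨a, b, rfl⟩ := Submodule.mem_span_pair.1 hy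
        rw [inner_add_left, real_inner_smul_left, real_inner_smul_left, h1, h2]
        ring
    -- Skewness makes the orthogonal complement invariant too, and the induction continues there.
    have hmaps : ∀ x ∈ Uᗮ, A x ∈ Uᗮ := by
      intro x hx
      rw [hmem] at hx ⊢
      constructor
      · have := hskew v x
        rw [hAvf, real_inner_smul_left, hx.2] at this
        linarith
      · have := hskew f x
        rw [hAf, real_inner_smul_left, hx.1] at this
        linarith
    have hU : Module.finrank ℝ U = 2 := by
      have hon : Orthonormal ℝ ![v, f] := by
        rw [orthonormal_iff_ite]
        intro i j
        fin_cases i <;> fin_cases j <;>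
          simp [hvf, hv1, hf1, real_inner_comm v f]
      have h1 := finrank_span_eq_card hon.linearIndependent
      rw [Matrix.range_cons, Matrix.range_cons, Matrix.range_empty, Set.union_empty,
        Set.singleton_union] at h1
      simpa using h1
    have hW : Module.finrank ℝ Uᗮ = 2 * n := by
      have := Submodule.finrank_add_finrank_orthogonal U
      omega
    obtain ⟨e', f', μ', hμ', hon, he', hf'⟩ := ih (V := Uᗮ) (A.restrict hmaps)
      (fun x y => hskew x y) (fun x hx => Subtype.ext (hinj x (congrArg Subtype.val hx))) hW
    rw [orthonormal_iff_ite] at hon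
    have hee : ∀ i j, inner ℝ (e' i : V) (e' j) = if i = j then 1 else 0 := fun i j => by
      simpa using hon (Sum.inl i) (Sum.inl j)
    have hff : ∀ i j, inner ℝ (f' i : V) (f' j) = if i = j then 1 else 0 := fun i j => by
      simpa using hon (Sum.inr i) (Sum.inr j)
    have hef : ∀ i j, inner ℝ (e' i : V) (f' j) = 0 := fun i j => by
      simpa using hon (Sum.inl i) (Sum.inr j)
    have hfe : ∀ i j, inner ℝ (f' i : V) (e' j) = 0 := fun i j => by
      rw [real_inner_comm, hef]
    have hv' : ∀ x : Uᗮ, inner ℝ v (x : V) = 0 := fun x => ((hmem x).1 x.2).1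
    have hf'' : ∀ x : Uᗮ, inner ℝ f (x : V) = 0 := fun x => ((hmem x).1 x.2).2
    have hv'' : ∀ x : Uᗮ, inner ℝ (x : V) v = 0 := fun x => by rw [real_inner_comm, hv']
    have hf''' : ∀ x : Uᗮ, inner ℝ (x : V) f = 0 := fun x => by rw [real_inner_comm, hf'']
    refine ⟨Fin.cons v fun i => (e' i : V), Fin.cons f fun i => (f' i : V), Fin.cons μ μ',
      fun i => ?_, ?_, fun i => ?_, fun i => ?_⟩
    · refine Fin.cases ?_ (fun i => ?_) i
      · exact hμ0
      · exact hμ' i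
    · rw [orthonormal_iff_ite]
      rintro (i | i) (j | j) <;>
        refine Fin.cases ?_ (fun i => ?_) i <;> refine Fin.cases ?_ (fun j => ?_) j <;>
        simp [hee, hff, hef, hfe, hv', hf'', hv'', hf''', hvf, hv1, hf1, real_inner_comm v f,
          (Fin.succ_ne_zero _).symm]
    · refine Fin.cases ?_ (fun i => ?_) i
      · exact hAvf
      · exact congrArg Subtype.val (he' i)
    · refine Fin.cases ?_ (fun i => ?_) i
      · exact hAf
      · exact congrArg Subtype.val (hf' i)

/-- **Williamson's theorem**: a unimodular matrix is, up to a rotation on the left, the product of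
a pair-diagonal matrix and a symplectic matrix. -/
theorem exists_williamson {n : ℕ} (T : Matrix (Fin n ⊕ Fin n) (Fin n ⊕ Fin n) ℝ)
    (hT : T.det = 1) :
    ∃ (r : Fin n → ℝ) (S : Matrix (Fin n ⊕ Fin n) (Fin n ⊕ Fin n) ℝ)
      (O : PhaseSpace n ≃ₗᵢ[ℝ] PhaseSpace n),
      (∀ i, 0 < r i) ∧ ∏ i, r i = 1 ∧ S ∈ Matrix.symplecticGroup (Fin n) ℝ ∧
      ∀ x, pairDiagonal r (Matrix.toEuclideanLin S x) = O (Matrix.toEuclideanLin T x) := by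
  -- A is skew and invertible. An orthonormal basis Q in normal form gives Q A Qᵀ = D J D, where D
  -- carries the square roots of the μ i; then S = D⁻¹ Q T satisfies S J Sᵀ = J and D S = Q T.
  let A := T * Matrix.J (Fin n) ℝ * T.transpose
  have hAt : A.transpose = -A := by
    simp only [A, Matrix.transpose_mul, Matrix.transpose_transpose, Matrix.J_transpose]
    simp [Matrix.mul_assoc]
  have hAdet : IsUnit A.det := by
    simp only [A, Matrix.det_mul, Matrix.det_transpose, hT, one_mul, mul_one]
    exact Matrix.isUnit_det_J _ _
  have hin : ∀ x y : PhaseSpace n, inner ℝ x y = x.ofLp ⬝ᵥ y.ofLp := by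
    intro x y
    rw [PiLp.inner_apply, dotProduct]
    refine Finset.sum_congr rfl fun i _ => ?_
    simp [mul_comm]
  obtain ⟨e, f, μ, hμ, hon, he, hf⟩ := exists_skew_normal_form n (Matrix.toEuclideanLin A)
    (fun x y => by
      rw [hin, hin]
      simp only [Matrix.toEuclideanLin, Matrix.ofLp_toLpLin, Matrix.toLin'_apply]
      rw [dotProduct_comm, ← Matrix.dotProduct_transpose_mulVec, hAt, Matrix.neg_mulVec,
        dotProduct_neg])
    (fun x hx => by
      have h1 : A.mulVec x.ofLp = 0 := by
        simpa using congrArg WithLp.ofLp hx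
      have h2 : x.ofLp = 0 := by
        have := congrArg (A⁻¹.mulVec) h1
        rwa [Matrix.mulVec_mulVec, Matrix.nonsing_inv_mul _ hAdet, Matrix.one_mulVec,
          Matrix.mulVec_zero] at this
      ext i
      simp [h2])
    (by simp [two_mul])
  let b : Fin n ⊕ Fin n → PhaseSpace n := Sum.elim e f
  let B : OrthonormalBasis (Fin n ⊕ Fin n) ℝ (PhaseSpace n) :=
    OrthonormalBasis.mk (v := b) hon
      (hon.linearIndependent.span_eq_top_of_card_eq_finrank' (by simp)).ge
  let Q : Matrix (Fin n ⊕ Fin n) (Fin n ⊕ Fin n) ℝ := Matrix.of fun k l => b k l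
  let r : Fin n → ℝ := fun i => √(μ i)
  have hr : ∀ i, 0 < r i := fun i => Real.sqrt_pos.2 (hμ i)
  have hr2 : ∀ i, r i * r i = μ i := fun i => Real.mul_self_sqrt (hμ i).le
  let D : Matrix (Fin n ⊕ Fin n) (Fin n ⊕ Fin n) ℝ := Matrix.diagonal (Sum.elim r r)
  let D' : Matrix (Fin n ⊕ Fin n) (Fin n ⊕ Fin n) ℝ :=
    Matrix.diagonal (Sum.elim (fun i => (r i)⁻¹) fun i => (r i)⁻¹)
  have hDD : D * D' = 1 := by
    simp only [D, D', Matrix.diagonal_mul_diagonal, ← Matrix.diagonal_one]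
    congr 1
    ext (i | i) <;> simp [(hr i).ne']
  have hDD' : D' * D = 1 := mul_eq_one_comm.1 hDD
  have hD't : D'.transpose = D' := Matrix.diagonal_transpose _
  have hon' : ∀ k l, inner ℝ (b k) (b l) = if k = l then 1 else 0 :=
    orthonormal_iff_ite.1 hon
  have hQ : Q * Q.transpose = 1 := by
    ext k l
    rw [Matrix.one_apply, ← hon', hin]
    rfl
  have hQA : Q * A * Q.transpose = D * Matrix.J (Fin n) ℝ * D := by
    ext k l
    have h1 : (Q * A * Q.transpose) k l = inner ℝ (b k) (Matrix.toEuclideanLin A (b l)) := by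
      rw [hin, Matrix.mul_assoc]
      rfl
    rw [h1]
    simp only [D, Matrix.mul_diagonal, Matrix.diagonal_mul]
    rcases l with l | l
    · have h2 : Matrix.toEuclideanLin A (b (Sum.inl l)) = μ l • b (Sum.inr l) := he l
      rw [h2, inner_smul_right, hon']
      rcases k with k | k
      · simp [Matrix.J]
      · by_cases hkl : k = l
        · subst hkl
          simp [Matrix.J, ← hr2]
        · simp [Matrix.J, hkl]
    · have h2 : Matrix.toEuclideanLin A (b (Sum.inr l)) = -μ l • b (Sum.inl l) := hf l
      rw [h2, inner_smul_right, hon']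
      rcases k with k | k
      · by_cases hkl : k = l
        · subst hkl
          simp [Matrix.J, ← hr2]
        · simp [Matrix.J, hkl]
      · simp [Matrix.J]
  let S := D' * Q * T
  have hS : S ∈ Matrix.symplecticGroup (Fin n) ℝ := by
    rw [SymplecticGroup.mem_iff]
    calc S * Matrix.J (Fin n) ℝ * S.transpose
        = D' * (Q * A * Q.transpose) * D' := by
          simp only [S, A, Matrix.transpose_mul, hD't, Matrix.mul_assoc]
      _ = D' * D * Matrix.J (Fin n) ℝ * (D * D') := by
          rw [hQA]
          simp only [Matrix.mul_assoc]
      _ = Matrix.J (Fin n) ℝ := by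
          rw [hDD, hDD', Matrix.one_mul, Matrix.mul_one]
  have hDS : D * S = Q * T := by
    simp only [S]
    rw [← Matrix.mul_assoc, ← Matrix.mul_assoc, hDD, Matrix.one_mul]
  -- Since det S = det T = 1, (∏ r i)² = det D = det Q, whose square is 1; positivity of the product
  -- finishes.
  have hprod : ∏ i, r i = 1 := by
    have h1 : D.det = Q.det := by
      have := congrArg Matrix.det hDS
      rwa [Matrix.det_mul D S, Matrix.det_mul Q T, SymplecticGroup.det_eq_one hS, hT, mul_one,
        mul_one] at this
    have h2 : Q.det * Q.det = 1 := by
      have := congrArg Matrix.det hQ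
      rwa [Matrix.det_mul, Matrix.det_transpose, Matrix.det_one] at this
    have h3 : D.det = (∏ i, r i) * ∏ i, r i := by
      simp [D, Matrix.det_diagonal]
    have h4 : 0 < ∏ i, r i := Finset.prod_pos fun i _ => hr i
    rw [← h1, h3] at h2
    have h5 : (∏ i, r i) ^ 4 = 1 := by
      rw [← h2]
      ring
    exact (pow_eq_one_iff_of_nonneg h4.le (by norm_num)).1 h5
  refine ⟨r, S, B.repr, hr, hprod, hS, fun x => ?_⟩
  ext k
  rw [B.repr_apply_apply]
  have h1 : B k = b k := by simp [B]
  rw [h1, hin]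
  have h2 : (pairDiagonal r (Matrix.toEuclideanLin S x)).ofLp = (D * S).mulVec x.ofLp := by
    rw [← Matrix.mulVec_mulVec]
    rfl
  rw [h2, hDS, ← Matrix.mulVec_mulVec]
  rfl

end Williamson

/-! ### The symplectic mean width estimate -/

section Main

open ProbabilityTheory

theorem supportFun_image_isometry {ι : Type*} [Fintype ι] (A : Set (EuclideanSpace ℝ ι))
    (O : EuclideanSpace ℝ ι ≃ₗᵢ[ℝ] EuclideanSpace ℝ ι) (x : EuclideanSpace ℝ ι) :
    supportFun (O '' A) x = supportFun A (O.symm x) := by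
  unfold supportFun
  rw [Set.image_image]
  congr 2
  ext y
  rw [← O.symm.inner_map_map, O.symm_apply_apply]

/-- Invariance is inherited from the standard Gaussian measure after cancelling the positive factor
E‖G‖. -/
theorem IsSymmBounded.meanWidth_image_isometry {ι : Type*} [Fintype ι] [Nonempty ι]
    {A : Set (EuclideanSpace ℝ ι)} (hA : IsSymmBounded A)
    (O : EuclideanSpace ℝ ι ≃ₗᵢ[ℝ] EuclideanSpace ℝ ι) :
    meanWidth (O '' A) = meanWidth A := by
  have hOA : IsSymmBounded (O '' A) :=
    hA.image (O.toLinearEquiv : EuclideanSpace ℝ ι →ₗ[ℝ] EuclideanSpace ℝ ι)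
  have h1 := hOA.integral_supportFun
  simp_rw [supportFun_image_isometry] at h1
  rw [integral_comp_isometry _ hA.continuous_supportFun, hA.integral_supportFun] at h1
  have hd : (0 : ℝ) < Fintype.card ι := by exact_mod_cast Fintype.card_pos
  have h2 : 0 < √(2 / Real.pi) * √(Fintype.card ι) := by positivity
  exact (mul_left_cancel₀ (h2.trans_le le_integral_norm_stdGaussian).ne' h1).symm

theorem IsSymmBounded.meanWidth_le_gaussRMS {ι : Type*} [Fintype ι] [Nonempty ι]
    {A : Set (EuclideanSpace ℝ ι)} (hA : IsSymmBounded A) :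
    √(2 / Real.pi) * √(Fintype.card ι) * meanWidth A ≤ gaussRMS (supportFun A) := by
  obtain ⟨C, hC0, hC⟩ := hA.exists_supportFun_le_mul_norm
  have hmem := memLp_of_le_norm hA.continuous_supportFun hA.supportFun_nonneg hC
  have h1 : ∫ x, supportFun A x ∂(stdGaussian (EuclideanSpace ℝ ι)) ≤ gaussRMS (supportFun A) := by
    refine Real.le_sqrt_of_sq_le ?_
    have := variance_nonneg (supportFun A) (stdGaussian (EuclideanSpace ℝ ι))
    rw [variance_eq_sub hmem] at this
    simpa using this
  rw [hA.integral_supportFun] at h1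
  exact (mul_le_mul_of_nonneg_right le_integral_norm_stdGaussian hA.meanWidth_nonneg).trans h1

/-- Some unimodular image of `K` has mean width controlled by the Rademacher constant and the
volume radius. -/
theorem SymmetricConvexBody.exists_meanWidth_le {n : ℕ} (hn : 0 < n)
    (K : SymmetricConvexBody (PhaseSpace n)) :
    ∃ T : Matrix (Fin n ⊕ Fin n) (Fin n ⊕ Fin n) ℝ, T.det = 1 ∧
      meanWidth (Matrix.toEuclideanLin T '' K.carrier) ≤
        5 * (√(2 / Real.pi))⁻¹ * (rademacherConst K.Space).toReal *
          (volume.real K.carrier / volume.real (Metric.ball (0 : PhaseSpace n) 1)) ^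
            (1 / (2 * (n : ℝ))) := by
  have : Nonempty (Fin n) := ⟨⟨0, hn⟩⟩
  obtain ⟨a, ha0, ha⟩ := K.exists_norm_le_gauge
  obtain ⟨b, hb0, hb⟩ := K.exists_gauge_le_norm
  obtain ⟨u, w, hu, hwu, huw, hpos, hlewis⟩ :=
    exists_lewis_position K.seminorm ha0 hb0.le ha hb
  have hdual := gaussRMS_mul_gaussRMS_dual_le K w hpos hlewis
  have hvol := K.sqrt_le_gaussRMS_mul_volume hn u hu hpos
  set ℓ := gaussRMS fun x => K.seminorm (u x)
  set R := (rademacherConst K.Space).toReal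
  set q := (volume.real K.carrier / volume.real (Metric.ball (0 : PhaseSpace n) 1)) ^
            (1 / (2 * (n : ℝ)))
  have hR : 0 ≤ R := ENNReal.toReal_nonneg
  let w' : PhaseSpace n →ₗ[ℝ] PhaseSpace n := w
  have hT : Matrix.toEuclideanLin (Matrix.toEuclideanLin.symm w') = w' :=
    LinearEquiv.apply_symm_apply _ _
  have hA : IsSymmBounded (w '' K.carrier) := K.isSymmBounded.image w'
  refine ⟨Matrix.toEuclideanLin.symm w', ?_, ?_⟩
  · have h1 : LinearMap.det w' = 1 := by
      have h2 : w' ∘ₗ (u : PhaseSpace n →ₗ[ℝ] PhaseSpace n) = LinearMap.id := by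
        ext1 x
        exact hwu x
      have h3 := congrArg LinearMap.det h2
      have hu' : LinearMap.det (u : PhaseSpace n →ₗ[ℝ] PhaseSpace n) = 1 := hu
      rwa [LinearMap.det_comp, hu', mul_one, LinearMap.det_id] at h3
    rw [← h1]
    conv_rhs => rw [← hT]
    rw [Matrix.toEuclideanLin_eq_toLin_orthonormal, LinearMap.det_toLin]
  · rw [hT]
    change meanWidth (w '' K.carrier) ≤ _
    have hm := hA.meanWidth_le_gaussRMS
    have hcard : (Fintype.card (Fin n ⊕ Fin n) : ℝ) = 2 * n := by
      simp [two_mul]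
    rw [hcard] at hm hdual
    have hn' : (0 : ℝ) < n := by exact_mod_cast hn
    have hs : 0 < √(2 * (n : ℝ)) := by positivity
    have hc : 0 < √(2 / Real.pi) := by positivity
    have hss : √(2 * (n : ℝ)) * √(2 * (n : ℝ)) = 2 * n := Real.mul_self_sqrt (by positivity)
    set M := meanWidth (w '' K.carrier)
    -- Duality bounds ℓ times the dual quadratic mean by 2nR, and the volume estimate trades one
    -- factor √(2n) for 5ℓq; then ℓ√(2n) cancels.
    have h1 : ℓ * √(2 * (n : ℝ)) * (√(2 / Real.pi) * M) ≤
        ℓ * √(2 * (n : ℝ)) * (5 * R * q) := by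
      calc ℓ * √(2 * (n : ℝ)) * (√(2 / Real.pi) * M)
          = ℓ * (√(2 / Real.pi) * √(2 * (n : ℝ)) * M) := by ring
        _ ≤ 2 * n * R := (mul_le_mul_of_nonneg_left hm hpos.le).trans hdual
        _ = √(2 * (n : ℝ)) * R * √(2 * (n : ℝ)) := by
          linear_combination (-R) * hss
        _ ≤ √(2 * (n : ℝ)) * R * (5 * ℓ * q) :=
          mul_le_mul_of_nonneg_left hvol (by positivity)
        _ = _ := by ring
    have h2 := le_of_mul_le_mul_left h1 (by positivity)
    rw [← le_inv_mul_iff₀ hc] at h2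
    calc M ≤ _ := h2
      _ = _ := by ring

end Main

end SymplecticMeanWidth
end

/-! ### Assembly of the two inequalities. -/

open SymplecticMeanWidth
theorem mainTheorem6 :
    ∃ A₃ A₆ : ℝ, 0 < A₃ ∧ 0 < A₆ ∧
      ∀ (n : ℕ), 0 < n → ∀ K : SymmetricConvexBody (PhaseSpace n),
        ∃ (r : Fin n → ℝ) (S : Matrix (Fin n ⊕ Fin n) (Fin n ⊕ Fin n) ℝ),
          (∀ i, 0 < r i) ∧ ∏ i, r i = 1 ∧ S ∈ Matrix.symplecticGroup (Fin n) ℝ ∧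
          signWidth (pairDiagonal r '' (Matrix.toEuclideanLin S '' K.carrier)) ≤
            A₃ * meanWidth (pairDiagonal r '' (Matrix.toEuclideanLin S '' K.carrier)) ∧
          A₃ * meanWidth (pairDiagonal r '' (Matrix.toEuclideanLin S '' K.carrier)) ≤
            A₃ * A₆ * (rademacherConst K.Space).toReal *
              (MeasureTheory.volume.real K.carrier /
                MeasureTheory.volume.real (Metric.ball (0 : PhaseSpace n) 1)) ^
                (1 / (2 * (n : ℝ))) := by
  have hc : 0 < (√(2 / Real.pi))⁻¹ := by positivity
  refine ⟨(√(2 / Real.pi))⁻¹, 5 * (√(2 / Real.pi))⁻¹, hc, by positivity, fun n hn K => ?_⟩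
  have : Nonempty (Fin n) := ⟨⟨0, hn⟩⟩
  obtain ⟨T, hT, hM⟩ := K.exists_meanWidth_le hn
  obtain ⟨r, S, O, hr, hprod, hS, hO⟩ := exists_williamson T hT
  -- DSK is a rotated copy of TK, so the bound for the unimodular T carries over to the symplectic
  -- position.
  have himage : pairDiagonal r '' (Matrix.toEuclideanLin S '' K.carrier) =
      O '' (Matrix.toEuclideanLin T '' K.carrier) := by
    simp_rw [Set.image_image, hO]
  have hTK : IsSymmBounded (Matrix.toEuclideanLin T '' K.carrier) := K.isSymmBounded.image _
  refine ⟨r, S, hr, hprod, hS, ((K.isSymmBounded.image _).image _).signWidth_le, ?_⟩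
  rw [himage, hTK.meanWidth_image_isometry]
  calc _ ≤ _ := mul_le_mul_of_nonneg_left hM hc.le
    _ = _ := by ring
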